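/- **Setting.** Let $H$ be a (finite-dimensional) Lie group with Lie algebra $\mathfrak h$, and let $H$ act smoothly on a finite-dimensional symplectic manifold $(P,\omega_P)$ preserving $\omega_P$; $H$ acts diagonally on $H\times P$ and on $T^*H\times P$ (from the left, by the cotangent lift on $T^*H$). Let $B$ be a smooth closed $H$-invariant two-form on $H\times P$ whose restriction to every slice $\{g\}\times P$ is $\omega_P$, and let $\Omega=\omega_{\rm can}-B$ on $T^*H\times P$, where $\omega_{\rm can}=-d\theta$ with $\theta$ the tautological one-form. Let $\phi:H\times P\to\mathfrak h^*$ be a smooth $B\mathfrak g$-potential: $\mathbf i_{\xi_{H\times P}}B=d\langle\phi,\xi\rangle$ for all $\xi\in\mathfrak h$. Its non-equivariance two-cocycle is $$\Sigma(\xi,\eta)=T_e\sigma_\eta(\xi),\qquad \sigma_\eta(g)(h,p)=-\langle\phi(gh,gp),\eta\rangle+\langle\phi(h,p),\mathrm{Ad}_{g^{-1}}\eta\rangle .$$ **Brackets.** Fix a sign convention $\varepsilon\in\{1,-1\}$. A nondegenerate two-form $\omega$ gives the bracket $\{F,K\}=\varepsilon\,X_K(F)$, where $\mathbf i_{X_K}\omega=dK$;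 $\{\cdot,\cdot\}_P$ is the bracket of $\omega_P$. The Lie–Poisson bracket on $\mathfrak h^*$ for the same convention (the one induced by $\omega_{\rm can}$ on $T^*H/H$) is $\{f,k\}_{\rm l.p}(\mu)=-\varepsilon\langle\mu,[\tfrac{\delta f}{\delta\mu},\tfrac{\delta k}{\delta\mu}]\rangle$. Let $\pi:T^*H\times P\to\mathfrak h^*\times P$, $\pi(\alpha_g,p)=(T^*L_g\alpha_g,\,g^{-1}p)$, be the quotient map by $H$. The interaction bracket is the reduced bracket, $\{f,k\}_{\rm int}\circ\pi=\{f\circ\pi,k\circ\pi\}_\Omega$. The natural bracket is $$\{f,k\}_\Sigma(\mu,x)=\{f(\cdot,x),k(\cdot,x)\}_{\rm l.p}(\mu)-\{f(\mu,\cdot),k(\mu,\cdot)\}_P(x)+\varepsilon\,\Sigma\big(\tfrac{\delta f}{\delta\mu},\tfrac{\delta k}{\delta\mu}\big)(e,x);$$ thus for $\varepsilon=-1$ it is Lie–Poisson minus the $P$-bracket minus $\Sigma$, and for $\varepsilon=1$ it is the negative of the bracket obtained for $\varepsilon=-1$. **Theorem.** For both sign conventions, $\Omega$ is nondegenerate,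 the bracket $\{\cdot,\cdot\}_{\rm int}$ on smooth functions is well defined by the formula above, and the shift map $$\hat{\mathcal S}:\mathfrak h^*\times P\to\mathfrak h^*\times P,\qquad \hat{\mathcal S}(\mu,x)=(\mu-\phi(e,x),x),$$ is a Poisson isomorphism taking $\{\cdot,\cdot\}_{\rm int}$ to $\{\cdot,\cdot\}_\Sigma$: it is a diffeomorphism, and $$\{f\circ\hat{\mathcal S},\,k\circ\hat{\mathcal S}\}_{\rm int}=\{f,k\}_\Sigma\circ\hat{\mathcal S}\qquad\text{for all smooth } f,k \text{ on } \mathfrak h^*\times P .$$ -/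

import Mathlib

open Bundle Manifold
open scoped ContDiff

noncomputable section

/-! ### Differential forms on manifolds (without boundary) -/

section Forms

variable {E : Type*} [NormedAddCommGroup E] [NormedSpace ℝ E]
  {K : Type*} [TopologicalSpace K] (I : ModelWithCorners ℝ E K)
  {M : Type*} [TopologicalSpace M] [ChartedSpace K M]
  {E' : Type*} [NormedAddCommGroup E'] [NormedSpace ℝ E']
  {K' : Type*} [TopologicalSpace K'] (I' : ModelWithCorners ℝ E' K')
  {M' : Type*} [TopologicalSpace M'] [ChartedSpace K' M']

/-- A (not necessarily smooth) real differential `n`-form on the manifold `M`. -/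
abbrev DiffForm (M : Type*) [TopologicalSpace M] [ChartedSpace K M] (n : ℕ) : Type _ :=
  ∀ x : M, TangentSpace I x [⋀^Fin n]→L[ℝ] ℝ

/-- The pullback `f^* om` of a differential form. -/
def DiffForm.pullback {n : ℕ} (f : M → M') (om : DiffForm I' M' n) : DiffForm I M n :=
  fun x => (om (f x)).compContinuousLinearMap (mfderiv I I' f x)

/-- The expression of `om` in the chart centred at `x₀`: the pullback of `om` along the inverse
of that chart, a form on (an open subset of) the model vector space. -/
def DiffForm.inChart {n : ℕ} (om : DiffForm I M n) (x₀ : M) : E → E [⋀^Fin n]→L[ℝ] ℝ :=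
  fun y => (om ((extChartAt I x₀).symm y)).compContinuousLinearMap
    (mfderiv 𝓘(ℝ, E) I (extChartAt I x₀).symm y)

/-- The exterior derivative of a form on a manifold, computed at `x` in the chart at `x`. -/
def DiffForm.extD {n : ℕ} (om : DiffForm I M n) : DiffForm I M (n + 1) :=
  fun x => (extDeriv (DiffForm.inChart I om x) (extChartAt I x x)).compContinuousLinearMap
    (mfderiv I 𝓘(ℝ, E) (extChartAt I x) x)

/-- A form is smooth if all its chart expressions are. -/
def DiffForm.IsSmooth {n : ℕ} (om : DiffForm I M n) : Prop :=
  ∀ x₀ : M, ContDiffOn ℝ ∞ (DiffForm.inChart I om x₀) (extChartAt I x₀).target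

def DiffForm.IsClosed {n : ℕ} (om : DiffForm I M n) : Prop :=
  ∀ x : M, DiffForm.extD I om x = 0

def DiffForm.IsNondegenerate (om : DiffForm I M 2) : Prop :=
  ∀ (x : M) (u : TangentSpace I x), (∀ v : TangentSpace I x, om x ![u, v] = 0) → u = 0

/-- Symplectic form: smooth, closed and nondegenerate. -/
structure DiffForm.IsSymplectic (om : DiffForm I M 2) : Prop where
  smooth : DiffForm.IsSmooth I om
  closed : DiffForm.IsClosed I om
  nondegenerate : DiffForm.IsNondegenerate I om

open scoped Classical in
/-- The Hamiltonian vector field `X_F` of `F`, determined by `i_{X_F} om = dF`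
(it exists and is unique when `om` is nondegenerate and `M` is finite-dimensional). -/
def hamiltonianVectorField (om : DiffForm I M 2) (F : M → ℝ) (x : M) : TangentSpace I x :=
  if h : ∃ X : TangentSpace I x, ∀ v : TangentSpace I x, om x ![X, v] = mfderiv I 𝓘(ℝ, ℝ) F x v
  then h.choose else 0

/-- The Poisson bracket of a symplectic form. The sign `ε = ±1` fixes the convention:
`{F, K} = ε X_K(F) = ε om(X_F, X_K)`. -/
def symplecticBracket (ε : ℝ) (om : DiffForm I M 2) (F K : M → ℝ) (x : M) : ℝ :=
  ε * (show ℝ from mfderiv I 𝓘(ℝ, ℝ) F x (hamiltonianVectorField I om K x))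

end Forms

/-! ### Lie groups, cotangent bundle and magnetic form

`H` is a Lie group modelled on the vector space `E`. Its Lie algebra
`𝔥 = T_e H = GroupLieAlgebra 𝓘(ℝ, E) H` is, as a vector space, `E` by definition of the tangent
spaces, so that `𝔥^*` is the normed space `E →L[ℝ] ℝ`. -/

section Coupling

variable {E : Type*} [NormedAddCommGroup E] [NormedSpace ℝ E]
  {H : Type*} [TopologicalSpace H] [ChartedSpace E H] [Group H]
  {V : Type*} [NormedAddCommGroup V] [NormedSpace ℝ V]
  {P : Type*} [TopologicalSpace P] [ChartedSpace V P] [MulAction H P]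

/-- The dual `𝔥^*` of the Lie algebra. -/
abbrev LieDual (E : Type*) [NormedAddCommGroup E] [NormedSpace ℝ E] : Type _ := E →L[ℝ] ℝ

/-- The bracket of the Lie algebra `𝔥` of `H`. -/
def lieBr (H : Type*) [TopologicalSpace H] [ChartedSpace E H] [Group H] (ξ η : E) : E :=
  (⁅(show GroupLieAlgebra 𝓘(ℝ, E) H from ξ), (show GroupLieAlgebra 𝓘(ℝ, E) H from η)⁆ :
    GroupLieAlgebra 𝓘(ℝ, E) H)

/-- The adjoint action `Ad_g : 𝔥 → 𝔥`, the derivative at the identity of conjugation by `g`. -/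
def lieAd (g : H) : E →L[ℝ] E :=
  (mfderiv 𝓘(ℝ, E) 𝓘(ℝ, E) (fun h : H => g * h * g⁻¹) 1 :)

/-- The cotangent bundle `T^*H`. -/
abbrev Cotangent (E : Type*) [NormedAddCommGroup E] [NormedSpace ℝ E]
    (H : Type*) [TopologicalSpace H] [ChartedSpace E H] [Group H]
    [LieGroup 𝓘(ℝ, E) ∞ H] : Type _ :=
  TotalSpace (E →L[ℝ] ℝ)
    (fun g : H => TangentSpace 𝓘(ℝ, E) g →L[ℝ] Bundle.Trivial H ℝ g)

variable [LieGroup 𝓘(ℝ, E) ∞ H]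

/-- Model with corners of `T^*H`. -/
abbrev cotModel (E : Type*) [NormedAddCommGroup E] [NormedSpace ℝ E] :
    ModelWithCorners ℝ (E × (E →L[ℝ] ℝ)) (ModelProd E (E →L[ℝ] ℝ)) :=
  𝓘(ℝ, E).prod 𝓘(ℝ, E →L[ℝ] ℝ)

/-- The tautological one-form `θ(α)(w) = α(Tπ w)` on `T^*H`. -/
def tautologicalForm (E : Type*) [NormedAddCommGroup E] [NormedSpace ℝ E]
    (H : Type*) [TopologicalSpace H] [ChartedSpace E H] [Group H]
    [LieGroup 𝓘(ℝ, E) ∞ H] :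
    DiffForm (cotModel E) (Cotangent E H) 1 := fun α =>
  ContinuousAlternatingMap.ofSubsingleton ℝ _ ℝ (0 : Fin 1)
    (ContinuousLinearMap.comp (α.2 : TangentSpace 𝓘(ℝ, E) α.1 →L[ℝ] ℝ)
      (mfderiv (cotModel E) 𝓘(ℝ, E) (fun β : Cotangent E H => β.1) α))

/-- The canonical symplectic form `ω_can = - dθ` (that is, `dq ∧ dp`) on `T^*H`. -/
def canonicalForm (E : Type*) [NormedAddCommGroup E] [NormedSpace ℝ E]
    (H : Type*) [TopologicalSpace H] [ChartedSpace E H] [Group H]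
    [LieGroup 𝓘(ℝ, E) ∞ H] :
    DiffForm (cotModel E) (Cotangent E H) 2 :=
  fun α => - DiffForm.extD (cotModel E) (tautologicalForm E H) α

/-- The magnetic form `Ω = ω_can - B` on `T^*H × P`, for a two-form `B` on `H × P`. -/
def magneticForm (B : DiffForm (𝓘(ℝ, E).prod 𝓘(ℝ, V)) (H × P) 2) :
    DiffForm ((cotModel E).prod 𝓘(ℝ, V)) (Cotangent E H × P) 2 := fun z =>
  DiffForm.pullback ((cotModel E).prod 𝓘(ℝ, V)) (cotModel E) Prod.fst (canonicalForm E H) z -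
  DiffForm.pullback ((cotModel E).prod 𝓘(ℝ, V)) (𝓘(ℝ, E).prod 𝓘(ℝ, V))
    (fun w : Cotangent E H × P => (w.1.1, w.2)) B z

/-! ### Group action and `B𝔤`-potential -/

/-- The fundamental vector field `ξ_{H × P}` of the diagonal action `h · (g, p) = (h g, h · p)`. -/
def fundVF (ξ : E) (z : H × P) : TangentSpace (𝓘(ℝ, E).prod 𝓘(ℝ, V)) z :=
  (mfderiv 𝓘(ℝ, E) (𝓘(ℝ, E).prod 𝓘(ℝ, V)) (fun h : H => (h * z.1, h • z.2)) 1 ξ :)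

/-- A two-form on `H × P` is invariant under the diagonal action of `H`. -/
def IsDiagInvariant (B : DiffForm (𝓘(ℝ, E).prod 𝓘(ℝ, V)) (H × P) 2) : Prop :=
  ∀ h : H, DiffForm.pullback (𝓘(ℝ, E).prod 𝓘(ℝ, V)) (𝓘(ℝ, E).prod 𝓘(ℝ, V))
    (fun z : H × P => (h * z.1, h • z.2)) B = B

/-- `φ : H × P → 𝔥^*` is a `B𝔤`-potential: `i_{ξ_{H × P}} B = d⟨φ, ξ⟩` for all `ξ ∈ 𝔥`. -/
structure IsBgPotential (B : DiffForm (𝓘(ℝ, E).prod 𝓘(ℝ, V)) (H × P) 2)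
    (φ : H × P → LieDual E) : Prop where
  smooth : ContMDiff (𝓘(ℝ, E).prod 𝓘(ℝ, V)) 𝓘(ℝ, LieDual E) ∞ φ
  potential : ∀ (ξ : E) (z : H × P) (v : TangentSpace (𝓘(ℝ, E).prod 𝓘(ℝ, V)) z),
    B z ![fundVF ξ z, v] = mfderiv (𝓘(ℝ, E).prod 𝓘(ℝ, V)) 𝓘(ℝ, ℝ) (fun w => φ w ξ) z v

/-- The one-cocycle `σ(g) · η`, the function
`(h, p) ↦ - ⟨φ(g h, g p), η⟩ + ⟨Ad^*_g φ(h, p), η⟩` on `H × P`, where `Ad^*_g` is the coadjoint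
action, `⟨Ad^*_g μ, η⟩ = ⟨μ, Ad_{g⁻¹} η⟩`. It vanishes when `φ` is equivariant. -/
def oneCocycle (φ : H × P → LieDual E) (η : E) (g : H) (z : H × P) : ℝ :=
  - φ (g * z.1, g • z.2) η + φ z (lieAd g⁻¹ η)

/-- The non-equivariance two-cocycle `Σ(ξ, η) = T_e σ_η (ξ)`, a function on `H × P`. -/
def twoCocycle (φ : H × P → LieDual E) (ξ η : E) (z : H × P) : ℝ :=
  (mfderiv 𝓘(ℝ, E) 𝓘(ℝ, ℝ) (fun g : H => oneCocycle φ η g z) 1 ξ :)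

/-! ### The two brackets on `𝔥^* × P` and the shift map -/

/-- Model with corners of `𝔥^* × P`. -/
abbrev redModel (E V : Type*) [NormedAddCommGroup E] [NormedSpace ℝ E]
    [NormedAddCommGroup V] [NormedSpace ℝ V] :
    ModelWithCorners ℝ (LieDual E × V) (ModelProd (LieDual E) V) :=
  𝓘(ℝ, LieDual E).prod 𝓘(ℝ, V)

/-- The quotient map `T^*H × P → 𝔥^* × P` of the diagonal action of `H`,
`(α_g, p) ↦ (T^*L_g α_g, g⁻¹ · p)`. -/
def reductionMap (z : Cotangent E H × P) : LieDual E × P :=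
  (ContinuousLinearMap.comp (z.1.2 : E →L[ℝ] ℝ)
      (mfderiv 𝓘(ℝ, E) 𝓘(ℝ, E) (fun h : H => z.1.1 * h) 1 : E →L[ℝ] E),
    z.1.1⁻¹ • z.2)

/-- The interaction bracket on `𝔥^* × P`: the value at `(μ, x)` of the reduced bracket, that is,
of the bracket of `Ω = ω_can - B` on functions pulled back by the quotient map, computed at the
point `(μ ∈ T_e^*H, x)` over `(μ, x)`. -/
def interactionBracket (ε : ℝ) (B : DiffForm (𝓘(ℝ, E).prod 𝓘(ℝ, V)) (H × P) 2)
    (f k : LieDual E × P → ℝ) (m : LieDual E × P) : ℝ :=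
  symplecticBracket ((cotModel E).prod 𝓘(ℝ, V)) ε (magneticForm B)
    (f ∘ reductionMap (H := H)) (k ∘ reductionMap (H := H))
    ((⟨1, m.1⟩ : Cotangent E H), m.2)

/-- The functional derivative `δf/δμ ∈ 𝔥`, characterised by
`d/dt f(μ + t ρ, x) = ⟨ρ, δf/δμ⟩` at `t = 0`, through the identification of the finite-dimensional
space `𝔥` with its bidual. -/
def funDeriv {P : Type*} [FiniteDimensional ℝ E] (f : LieDual E × P → ℝ) (m : LieDual E × P) : E :=
  (Module.evalEquiv ℝ E).symm
    ((fderiv ℝ (fun ν : LieDual E => f (ν, m.2)) m.1 : LieDual E →ₗ[ℝ] ℝ) ∘ₗ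
      (LinearMap.toContinuousLinearMap : (E →ₗ[ℝ] ℝ) ≃ₗ[ℝ] (E →L[ℝ] ℝ)).toLinearMap)

/-- The defining property of `δf/δμ`. -/
theorem apply_funDeriv {P : Type*} [FiniteDimensional ℝ E] (f : LieDual E × P → ℝ)
    (m : LieDual E × P)
    (ρ : LieDual E) :
    ρ (funDeriv f m) = fderiv ℝ (fun ν : LieDual E => f (ν, m.2)) m.1 ρ := by
  have h := Module.apply_evalEquiv_symm_apply ℝ E (ρ : E →ₗ[ℝ] ℝ)
    ((fderiv ℝ (fun ν : LieDual E => f (ν, m.2)) m.1 : LieDual E →ₗ[ℝ] ℝ) ∘ₗ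
      (LinearMap.toContinuousLinearMap : (E →ₗ[ℝ] ℝ) ≃ₗ[ℝ] (E →L[ℝ] ℝ)).toLinearMap)
  exact h

/-- The Lie-Poisson bracket `-ε ⟨μ, [δf/δμ, δk/δμ]⟩` in the variable `μ`; with the convention `ε`
this is the bracket induced by the canonical symplectic form of `T^*H` on `T^*H / H = 𝔥^*`. -/
def liePoisson [FiniteDimensional ℝ E] (H : Type*) [TopologicalSpace H] [ChartedSpace E H]
    [Group H] (ε : ℝ) (f k : LieDual E × P → ℝ) (m : LieDual E × P) : ℝ :=
  -ε * m.1 (lieBr H (funDeriv f m) (funDeriv k m))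

/-- The natural bracket on `𝔥^* × P`. For `ε = -1` it is
`{f, k}_lp - {f, k}_P - Σ(δf/δμ, δk/δμ)`; passing to `ε = 1` negates each of the brackets, so that
the cocycle term then reads `+ Σ(δf/δμ, δk/δμ)`. The cocycle is evaluated at `(e, x)`. -/
def naturalBracket [FiniteDimensional ℝ E] (ε : ℝ) (ωP : DiffForm 𝓘(ℝ, V) P 2)
    (φ : H × P → LieDual E) (f k : LieDual E × P → ℝ) (m : LieDual E × P) : ℝ :=
  liePoisson H ε f k m
    - symplecticBracket 𝓘(ℝ, V) ε ωP (fun y => f (m.1, y)) (fun y => k (m.1, y)) m.2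
    + ε * twoCocycle φ (funDeriv f m) (funDeriv k m) (1, m.2)

/-- The shift map `Ŝ(μ, x) = (μ - φ(e, x), x)`. -/
def shiftMap (φ : H × P → LieDual E) (m : LieDual E × P) : LieDual E × P :=
  (m.1 - φ (1, m.2), m.2)

/-- `S` is a Poisson isomorphism of `𝔥^* × P` taking the bracket `br` to the bracket `br'`:
a diffeomorphism with `{f ∘ S, k ∘ S} = {f, k}' ∘ S` for all smooth `f`, `k`. -/
def IsPoissonIso (br br' : (LieDual E × P → ℝ) → (LieDual E × P → ℝ) → LieDual E × P → ℝ)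
    (S : LieDual E × P → LieDual E × P) : Prop :=
  (∃ D : (LieDual E × P) ≃ₘ^∞⟮redModel E V, redModel E V⟯ (LieDual E × P), ⇑D = S) ∧
  ∀ f k : LieDual E × P → ℝ,
    ContMDiff (redModel E V) 𝓘(ℝ, ℝ) ∞ f → ContMDiff (redModel E V) 𝓘(ℝ, ℝ) ∞ k →
    br (f ∘ S) (k ∘ S) = br' f k ∘ S

end Coupling

end

noncomputable section

/-! ### The manifold derivative as a map of model spaces -/

section TDeriv

open Filter Topology

variable {E : Type*} [NormedAddCommGroup E] [NormedSpace ℝ E]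
  {K : Type*} [TopologicalSpace K] {I : ModelWithCorners ℝ E K}
  {M : Type*} [TopologicalSpace M] [ChartedSpace K M]
  {E' : Type*} [NormedAddCommGroup E'] [NormedSpace ℝ E']
  {K' : Type*} [TopologicalSpace K'] {I' : ModelWithCorners ℝ E' K'}
  {M' : Type*} [TopologicalSpace M'] [ChartedSpace K' M']
  {E'' : Type*} [NormedAddCommGroup E''] [NormedSpace ℝ E'']
  {K'' : Type*} [TopologicalSpace K''] {I'' : ModelWithCorners ℝ E'' K''}
  {M'' : Type*} [TopologicalSpace M''] [ChartedSpace K'' M'']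

/-! At a point `(α_g, p)` a tangent vector `u` of `T^*H × P` is described by three data: its
left-trivialised `H`-component `ξ`, the derivative `n` of the shifted momentum `T^*L_g α_g - φ(e,
g⁻¹p)` along `u`, and the derivative `a` of `g⁻¹p` along `u`. The pair `(n, a)` is the image of `u`
under the derivative of `Ŝ ∘ π`. In these data (`magneticForm_reduced`) `Ω(u, w) = n_w(ξ) - n_u(η) +
⟨m, [ξ, η]⟩ - ω_P(a, b) - Σ(ξ, η)`, where `m` is the shifted momentum.

Three facts give this formula. In the left trivialisation `ω_can` is the derivative of the momentum
plus a bracket term (`canonicalForm_leftTrans`). By invariance `B` may be evaluated at `(e, g⁻¹p)`,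
where each vector is an orbit vector plus a vector along `P`. Finally the potential turns mixed
terms of `B` into derivatives of `φ`, absorbed by the shift, while the orbit-orbit term is `Σ(ξ, η)
+ ⟨φ, [ξ, η]⟩`, by `twoCocycle_one` and the derivative of `Ad` (`hasDeriv_lieAd_inv`).

No term pairs `ξ` with `b`, so the Hamiltonian vector of `k ∘ Ŝ ∘ π` is read off: `ξ = δk/δμ`, its
`P`-part is minus the Hamiltonian vector of `k(m, ·)`, and pairing with `η = δf/δμ` gives the rest.
This yields the natural bracket at `Ŝ(π(z))` (`symplecticBracket_pullback`). Since `Ŝ` is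
invertible, every function on the quotient has the form `f ∘ Ŝ`, so the same formula shows that the
reduced bracket is well defined. -/

variable (I I') in
/-- The manifold derivative, as a map between the model vector spaces. -/
def tderiv (f : M → M') (x : M) : E →L[ℝ] E' := (mfderiv I I' f x :)

/-- For `tderiv` the types do not depend on the base point, so points such as `g * 1` and `g` can be
rewritten freely. -/
theorem tderiv_comp (x : M) {g : M' → M''} {f : M → M'} (hg : MDifferentiableAt I' I'' g (f x))
    (hf : MDifferentiableAt I I' f x) :
    tderiv I I'' (g ∘ f) x = (tderiv I' I'' g (f x)).comp (tderiv I I' f x) :=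
  mfderiv_comp x hg hf

theorem tderiv_comp_apply (x : M) {g : M' → M''} {f : M → M'}
    (hg : MDifferentiableAt I' I'' g (f x)) (hf : MDifferentiableAt I I' f x) (v : E) :
    tderiv I I'' (fun y => g (f y)) x v = tderiv I' I'' g (f x) (tderiv I I' f x v) :=
  congrArg (fun L : E →L[ℝ] E'' => L v) (tderiv_comp x hg hf)

theorem tderiv_id (x : M) : tderiv I I (fun y : M => y) x = ContinuousLinearMap.id ℝ E :=
  mfderiv_id

theorem tderiv_const (c : M') (x : M) : tderiv I I' (fun _ : M => c) x = 0 :=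
  mfderiv_const

theorem Filter.EventuallyEq.tderiv_eq {f g : M → M'} {x : M} (h : f =ᶠ[𝓝 x] g) :
    tderiv I I' f x = tderiv I I' g x := by
  have h0 : f x = g x := h.eq_of_nhds
  have h1 := h.mfderiv_eq (I := I) (I' := I')
  exact h1

theorem tderiv_eq_fderiv {f : E → E'} {x : E} : tderiv 𝓘(ℝ, E) 𝓘(ℝ, E') f x = fderiv ℝ f x :=
  mfderiv_eq_fderiv

theorem tderiv_prodMk {f : M → M'} {g : M → M''} {x : M} (hf : MDifferentiableAt I I' f x)
    (hg : MDifferentiableAt I I'' g x) :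
    tderiv I (I'.prod I'') (fun y => (f y, g y)) x = (tderiv I I' f x).prod (tderiv I I'' g x) :=
  mfderiv_prodMk hf hg

theorem tderiv_fst (x : M × M') :
    tderiv (I.prod I') I (Prod.fst : M × M' → M) x = ContinuousLinearMap.fst ℝ E E' :=
  mfderiv_fst

theorem tderiv_snd (x : M × M') :
    tderiv (I.prod I') I' (Prod.snd : M × M' → M') x = ContinuousLinearMap.snd ℝ E E' :=
  mfderiv_snd

/-- The tangent space at `x` is identified with the model space through the chart at `x` itself.
Hence centred charts reproduce vectors unchanged. -/
theorem tderiv_extChartAt_self [IsManifold I 1 M] (x : M) :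
    tderiv I 𝓘(ℝ, E) (extChartAt I x) x = ContinuousLinearMap.id ℝ E :=
  mfderiv_extChartAt_self

theorem tderiv_eq_fderiv_extChartAt [I.Boundaryless] {f : M → M'} {x : M}
    (hf : MDifferentiableAt I I' f x) :
    tderiv I I' f x =
      fderiv ℝ (fun y => extChartAt I' (f x) (f ((extChartAt I x).symm y)))
        (extChartAt I x x) := by
  have h := hf.mfderiv
  rw [I.range_eq_univ, fderivWithin_univ] at h
  exact h

theorem tderiv_extChartAt_symm_comp [IsManifold I 1 M] [I.Boundaryless] {x : M} {y : E}
    (hy : y ∈ (extChartAt I x).target) :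
    (tderiv 𝓘(ℝ, E) I (extChartAt I x).symm y).comp
    (tderiv I 𝓘(ℝ, E) (extChartAt I x) ((extChartAt I x).symm y))
       = ContinuousLinearMap.id ℝ E := by
  have h := mfderivWithin_extChartAt_symm_comp_mfderiv_extChartAt hy
  rw [I.range_eq_univ, mfderivWithin_univ] at h
  exact h

theorem tderiv_extChartAt_symm_self [IsManifold I 1 M] [I.Boundaryless] (x : M) :
    tderiv 𝓘(ℝ, E) I (extChartAt I x).symm (extChartAt I x x) = ContinuousLinearMap.id ℝ E := by
  have h := tderiv_extChartAt_symm_comp (I := I) (mem_extChartAt_target x)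
  rwa [extChartAt_to_inv, tderiv_extChartAt_self, ContinuousLinearMap.comp_id] at h

theorem mdifferentiableAt_extChartAt_symm [IsManifold I 1 M] [I.Boundaryless] {x : M} {y : E}
    (hy : y ∈ (extChartAt I x).target) :
    MDifferentiableAt 𝓘(ℝ, E) I (extChartAt I x).symm y := by
  have h := mdifferentiableWithinAt_extChartAt_symm hy
  rwa [I.range_eq_univ, mdifferentiableWithinAt_univ] at h

end TDeriv

/-! ### Left-invariant vector fields in charts -/

section LeftInvariant

open VectorField Filter Topology

variable {E : Type*} [NormedAddCommGroup E] [NormedSpace ℝ E]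
  {H : Type*} [TopologicalSpace H] [ChartedSpace E H] [Group H]

/-- The derivative at the identity of left translation by `g`, as a map `E → E`. -/
def leftTrans (g : H) : E →L[ℝ] E := tderiv 𝓘(ℝ, E) 𝓘(ℝ, E) (fun h : H => g * h) 1

/-- The left-invariant vector field of `ξ`, in the chart centred at `g`. -/
def leftField (g : H) (ξ : E) (y : E) : E :=
  tderiv 𝓘(ℝ, E) 𝓘(ℝ, E) (extChartAt 𝓘(ℝ, E) g) ((extChartAt 𝓘(ℝ, E) g).symm y)
    (leftTrans ((extChartAt 𝓘(ℝ, E) g).symm y) ξ)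

section
variable [LieGroup 𝓘(ℝ, E) ∞ H]

variable (E H) in
theorem lieGroup_minSmoothness_three : LieGroup 𝓘(ℝ, E) (minSmoothness ℝ 3) H := by
  rw [minSmoothness_of_isRCLikeNormedField]
  infer_instance

variable (E H) in
theorem isManifold_one_of_lieGroup : IsManifold 𝓘(ℝ, E) 1 H :=
  have : IsManifold 𝓘(ℝ, E) ∞ H := inferInstance
  IsManifold.of_le (n := ∞) (by simp)

theorem mdifferentiableAt_leftMul (g a : H) :
    MDifferentiableAt 𝓘(ℝ, E) 𝓘(ℝ, E) (fun h : H => g * h) a :=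
  (contMDiff_mul_left (I := 𝓘(ℝ, E)) (n := ∞)).mdifferentiable (by simp) a

omit [LieGroup 𝓘(ℝ, E) ∞ H] in
variable (E H) in
theorem leftTrans_one : leftTrans (1 : H) = ContinuousLinearMap.id ℝ E := by
  unfold leftTrans
  simp only [one_mul]
  exact tderiv_id 1

/-- The derivative of left translation by `g⁻¹` at `g` inverts `leftTrans g`. -/
theorem leftTrans_inverse (g : H) :
    (tderiv 𝓘(ℝ, E) 𝓘(ℝ, E) (fun h : H => g⁻¹ * h) g).comp (leftTrans g) =
      ContinuousLinearMap.id ℝ E ∧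
    (leftTrans g).comp (tderiv 𝓘(ℝ, E) 𝓘(ℝ, E) (fun h : H => g⁻¹ * h) g) =
      ContinuousLinearMap.id ℝ E := by
  have h1 := tderiv_comp (I := 𝓘(ℝ, E)) (I' := 𝓘(ℝ, E)) (I'' := 𝓘(ℝ, E)) (1 : H)
    (mdifferentiableAt_leftMul (E := E) g⁻¹ (g * 1)) (mdifferentiableAt_leftMul (E := E) g 1)
  have h2 := tderiv_comp (I := 𝓘(ℝ, E)) (I' := 𝓘(ℝ, E)) (I'' := 𝓘(ℝ, E)) g
    (mdifferentiableAt_leftMul (E := E) g (g⁻¹ * g)) (mdifferentiableAt_leftMul (E := E) g⁻¹ g)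
  have e1 : (fun h : H => g⁻¹ * h) ∘ (fun h : H => g * h) = fun h => h := by ext; simp
  have e2 : (fun h : H => g * h) ∘ (fun h : H => g⁻¹ * h) = fun h => h := by ext; simp
  rw [e1, tderiv_id, mul_one] at h1
  rw [e2, tderiv_id, inv_mul_cancel] at h2
  exact ⟨h1.symm, h2.symm⟩

theorem leftTrans_bijective (g : H) : Function.Bijective (leftTrans (E := E) g) := by
  refine Function.bijective_iff_has_inverse.2
    ⟨tderiv 𝓘(ℝ, E) 𝓘(ℝ, E) (fun h : H => g⁻¹ * h) g, fun x => ?_, fun x => ?_⟩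
  · exact congrArg (fun L : E →L[ℝ] E => L x) (leftTrans_inverse g).1
  · exact congrArg (fun L : E →L[ℝ] E => L x) (leftTrans_inverse g).2

theorem leftField_center (g : H) (ξ : E) :
    leftField g ξ (extChartAt 𝓘(ℝ, E) g g) = leftTrans g ξ := by
  have := isManifold_one_of_lieGroup E H
  unfold leftField
  rw [extChartAt_to_inv, tderiv_extChartAt_self]
  rfl

/-- On the chart target the derivatives of the chart and of its inverse are mutually inverse, so
pushing forward by the one is pulling back by the other. This gives access to the known facts on
invariant vector fields. -/
theorem leftField_eventuallyEq (g : H) (ξ : E) :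
    leftField g ξ =ᶠ[𝓝 (extChartAt 𝓘(ℝ, E) g g)]
    mpullbackWithin 𝓘(ℝ, E) 𝓘(ℝ, E) (extChartAt 𝓘(ℝ, E) g).symm
      (mulInvariantVectorField (I := 𝓘(ℝ, E)) (G := H) ξ) (Set.range 𝓘(ℝ, E)) := by
  have := isManifold_one_of_lieGroup E H
  filter_upwards [extChartAt_target_mem_nhds (I := 𝓘(ℝ, E)) g] with y hy
  rw [mpullbackWithin_apply]
  rw [ContinuousLinearMap.inverse_eq (mfderivWithin_extChartAt_symm_comp_mfderiv_extChartAt hy)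
    (mfderiv_extChartAt_comp_mfderivWithin_extChartAt_symm hy)]
  rfl

variable [CompleteSpace E]

theorem differentiableAt_leftField (g : H) (ξ : E) :
    DifferentiableAt ℝ (leftField g ξ) (extChartAt 𝓘(ℝ, E) g g) := by
  have : IsManifold 𝓘(ℝ, E) ∞ H := inferInstance
  have : IsManifold 𝓘(ℝ, E) 2 H := IsManifold.of_le (n := ∞) ENat.LEInfty.out
  have := lieGroup_minSmoothness_three E H
  have h := mdifferentiableAt_mulInvariantVectorField (I := 𝓘(ℝ, E)) (G := H) ξ (g := g)
  rw [← mdifferentiableWithinAt_univ] at h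
  have h2 := h.differentiableWithinAt_mpullbackWithin_vectorField
  rw [Set.preimage_univ, Set.univ_inter] at h2
  have h3 := leftField_eventuallyEq g ξ
  simp only [modelWithCornersSelf_coe, Set.range_id] at h2 h3
  exact h3.differentiableAt_iff.2 (differentiableWithinAt_univ.1 h2)

-- The bracket on a manifold is computed in the chart and pulled back by its derivative, which is
-- the identity at the centre.
omit [Group H] [LieGroup 𝓘(ℝ, E) ∞ H] [CompleteSpace E] in
theorem mlieBracket_eq_lieBracket [IsManifold 𝓘(ℝ, E) 1 H] (g : H)
    (X Y : ∀ h : H, TangentSpace 𝓘(ℝ, E) h) :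
    (mlieBracket 𝓘(ℝ, E) X Y g : E) = lieBracket ℝ
      (mpullbackWithin 𝓘(ℝ, E) 𝓘(ℝ, E) (extChartAt 𝓘(ℝ, E) g).symm X (Set.range 𝓘(ℝ, E)))
      (mpullbackWithin 𝓘(ℝ, E) 𝓘(ℝ, E) (extChartAt 𝓘(ℝ, E) g).symm Y (Set.range 𝓘(ℝ, E)))
      (extChartAt 𝓘(ℝ, E) g g) := by
  have hinv : ∀ L : E →L[ℝ] E, L = ContinuousLinearMap.id ℝ E → ∀ v, L.inverse v = v := by
    rintro L rfl v
    rw [ContinuousLinearMap.inverse_id]; rfl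
  have hs : (extChartAt 𝓘(ℝ, E) g).symm ⁻¹' Set.univ ∩ Set.range 𝓘(ℝ, E) = Set.univ := by simp
  refine (hinv _ (tderiv_extChartAt_self (I := 𝓘(ℝ, E)) g) _).trans ?_
  exact (congrArg (fun s => lieBracketWithin ℝ (E := E) _ _ s _) hs).trans
    (congrFun lieBracketWithin_univ _)

/-- The bracket of left-invariant fields is again left-invariant, so its value at `g` is the
translate of the bracket at the identity; that value is then computed in the chart centred at `g`.
-/
theorem leftTrans_lieBr (g : H) (ξ η : E) :
    leftTrans g (lieBr H ξ η) =
      fderiv ℝ (leftField g η) (extChartAt 𝓘(ℝ, E) g g) (leftTrans g ξ) -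
      fderiv ℝ (leftField g ξ) (extChartAt 𝓘(ℝ, E) g g) (leftTrans g η) := by
  have := isManifold_one_of_lieGroup E H
  have := lieGroup_minSmoothness_three E H
  have h := congrFun (mulInvariantVector_mlieBracket (I := 𝓘(ℝ, E)) (G := H) ξ η) g
  have h1 : leftTrans g (lieBr H ξ η) = (mlieBracket 𝓘(ℝ, E)
    (mulInvariantVectorField (I := 𝓘(ℝ, E)) (G := H) ξ)
    (mulInvariantVectorField (I := 𝓘(ℝ, E)) (G := H) η) g : E) := h
  have hξ := leftField_eventuallyEq g ξ
  have hη := leftField_eventuallyEq g η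
  have h2 := hξ.lieBracket_vectorField_eq (𝕜 := ℝ) hη
  rw [lieBracket_eq] at h2
  beta_reduce at h2
  rw [leftField_center, leftField_center] at h2
  exact h1.trans ((mlieBracket_eq_lieBracket g _ _).trans h2.symm)

end
end LeftInvariant

/-! ### Canonical charts of the cotangent bundle -/

section Cotangent

open Filter Topology

variable {E : Type*} [NormedAddCommGroup E] [NormedSpace ℝ E]
  {H : Type*} [TopologicalSpace H] [ChartedSpace E H] [Group H] [LieGroup 𝓘(ℝ, E) ∞ H]

variable (E H) in
theorem isManifold_cotangent : IsManifold (cotModel E) 1 (Cotangent E H) := by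
  have : IsManifold 𝓘(ℝ, E) ∞ H := inferInstance
  have : IsManifold 𝓘(ℝ, E) 1 H := isManifold_one_of_lieGroup E H
  have : IsManifold 𝓘(ℝ, E) 2 H := IsManifold.of_le (n := ∞) ENat.LEInfty.out
  -- Transition maps of the bundle involve one derivative of those of the base, so order 2 on `H`
  -- gives order 1 on `T^*H`.
  have : IsManifold 𝓘(ℝ, E) (1 + 1) H := by simpa [one_add_one_eq_two] using this
  have : ContMDiffVectorBundle 1 E (TangentSpace 𝓘(ℝ, E) : H → Type _) 𝓘(ℝ, E) := inferInstance
  infer_instance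

/-- The covector `α`, as a functional on the model space. -/
def Cotangent.covector (α : Cotangent E H) : E →L[ℝ] ℝ := α.2

/-- The trivialisation of the dual bundle precomposes a covector with the inverse trivialisation of
`TH`, which is the derivative of the inverse chart. These are the canonical coordinates `(q, p)`. -/
theorem extChartAt_cotangent (α β : Cotangent E H) (h : β.1 ∈ (chartAt E α.1).source) :
    extChartAt (cotModel E) α β = (extChartAt 𝓘(ℝ, E) α.1 β.1,
      β.covector.comp (tderiv 𝓘(ℝ, E) 𝓘(ℝ, E) (extChartAt 𝓘(ℝ, E) α.1).symm
        (extChartAt 𝓘(ℝ, E) α.1 β.1))) := by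
  have := isManifold_one_of_lieGroup E H
  rw [FiberBundle.extChartAt]
  have h2 := TangentBundle.symmL_trivializationAt (I := 𝓘(ℝ, E)) h
  rw [modelWithCornersSelf_coe, Set.range_id, mfderivWithin_univ] at h2
  refine Prod.ext rfl ?_
  ext v
  change ((trivializationAt ℝ (Bundle.Trivial H ℝ) α.1).continuousLinearMapAt ℝ β.1)
    (β.2 ((trivializationAt E (TangentSpace 𝓘(ℝ, E)) α.1).symmL ℝ β.1 v)) = _
  have h3 := Bundle.Trivial.continuousLinearMapAt_trivialization ℝ H ℝ β.1
  exact (congrArg (fun L : ℝ →L[ℝ] ℝ => L _) h3).trans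
    (congrArg (fun L : E →L[ℝ] E => β.covector (L v)) h2)

theorem extChartAt_cotangent_target (α : Cotangent E H) :
    (extChartAt (cotModel E) α).target = (extChartAt 𝓘(ℝ, E) α.1).target ×ˢ Set.univ := by
  have := isManifold_one_of_lieGroup E H
  rw [FiberBundle.extChartAt_target]
  congr 1
  rw [hom_trivializationAt_baseSet, TangentBundle.trivializationAt_baseSet, Set.inter_eq_left]
  intro y hy
  refine ⟨?_, Set.mem_univ _⟩
  rw [← extChartAt_source 𝓘(ℝ, E)]
  exact (extChartAt 𝓘(ℝ, E) α.1).map_target hy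

theorem base_mem_source_of_mem_source {α β : Cotangent E H}
    (h : β ∈ (extChartAt (cotModel E) α).source) : β.1 ∈ (chartAt E α.1).source := by
  rw [FiberBundle.extChartAt] at h
  rw [← extChartAt_source 𝓘(ℝ, E)]
  exact h.2.1

/-- The base point and the covector of a point given in a canonical chart. -/
theorem extChartAt_cotangent_symm (α : Cotangent E H) {y : E × (E →L[ℝ] ℝ)}
    (hy : y ∈ (extChartAt (cotModel E) α).target) : 
    ((extChartAt (cotModel E) α).symm y).1 = (extChartAt 𝓘(ℝ, E) α.1).symm y.1 ∧
    ((extChartAt (cotModel E) α).symm y).covector.comp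
      (tderiv 𝓘(ℝ, E) 𝓘(ℝ, E) (extChartAt 𝓘(ℝ, E) α.1).symm y.1) = y.2 := by
  have hs : ((extChartAt (cotModel E) α).symm y) ∈ (extChartAt (cotModel E) α).source :=
    (extChartAt (cotModel E) α).map_target hy
  have h0 := (extChartAt (cotModel E) α).right_inv hy
  replace hs := base_mem_source_of_mem_source hs
  rw [extChartAt_cotangent _ _ hs] at h0
  have h1 := congrArg Prod.fst h0
  have h2 := congrArg Prod.snd h0
  dsimp only at h1 h2
  rw [h1] at h2
  refine ⟨?_, h2⟩
  rw [← h1, (extChartAt 𝓘(ℝ, E) α.1).left_inv]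
  rwa [extChartAt_source]

theorem tderiv_base_extChartAt_symm (α : Cotangent E H) {y : E × (E →L[ℝ] ℝ)}
    (hy : y ∈ (extChartAt (cotModel E) α).target) (v : E × (E →L[ℝ] ℝ)) :
    tderiv (cotModel E) 𝓘(ℝ, E) (fun β : Cotangent E H => β.1) ((extChartAt (cotModel E) α).symm y)
      (tderiv 𝓘(ℝ, E × (E →L[ℝ] ℝ)) (cotModel E) (extChartAt (cotModel E) α).symm y v) =
    tderiv 𝓘(ℝ, E) 𝓘(ℝ, E) (extChartAt 𝓘(ℝ, E) α.1).symm y.1 v.1 := by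
  have := isManifold_one_of_lieGroup E H
  have := isManifold_cotangent E H
  have hy1 : y.1 ∈ (extChartAt 𝓘(ℝ, E) α.1).target := by
    rw [extChartAt_cotangent_target] at hy
    exact hy.1
  have hproj : MDifferentiableAt (cotModel E) 𝓘(ℝ, E) (fun β : Cotangent E H => β.1)
      ((extChartAt (cotModel E) α).symm y) :=
    (contMDiff_proj (n := 1) _).mdifferentiableAt one_ne_zero
  have hsymm := mdifferentiableAt_extChartAt_symm (I := cotModel E) hy
  rw [← tderiv_comp_apply (I := 𝓘(ℝ, E × (E →L[ℝ] ℝ))) y hproj hsymm]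
  have he : (fun y => ((extChartAt (cotModel E) α).symm y).1) =ᶠ[𝓝 y]
      fun y => (extChartAt 𝓘(ℝ, E) α.1).symm y.1 := by
    filter_upwards [(isOpen_extChartAt_target (I := cotModel E) α).mem_nhds hy] with z hz
    exact (extChartAt_cotangent_symm α hz).1
  rw [he.tderiv_eq, tderiv_comp_apply (I := 𝓘(ℝ, E × (E →L[ℝ] ℝ))) (I' := 𝓘(ℝ, E)) y
    (mdifferentiableAt_extChartAt_symm hy1)
    (differentiableAt_fst.mdifferentiableAt), tderiv_eq_fderiv, fderiv_fst]
  rfl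

/-- This is `θ = p dq`: the derivative of the inverse chart in the definition of `p` is the one that
appears when the projection is composed with the chart. -/
theorem tautologicalForm_inChart (α : Cotangent E H) {y : E × (E →L[ℝ] ℝ)}
    (hy : y ∈ (extChartAt (cotModel E) α).target) :
    DiffForm.inChart (cotModel E) (tautologicalForm E H) α y =
     ContinuousAlternatingMap.ofSubsingleton ℝ _ ℝ (0 : Fin 1)
      (y.2.comp (ContinuousLinearMap.fst ℝ E (E →L[ℝ] ℝ))) := by
  ext v
  obtain ⟨h1, h2⟩ := extChartAt_cotangent_symm α hy
  change ((extChartAt (cotModel E) α).symm y).covector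
    (tderiv (cotModel E) 𝓘(ℝ, E) (fun β : Cotangent E H => β.1) ((extChartAt (cotModel E) α).symm y)
      (tderiv 𝓘(ℝ, E × (E →L[ℝ] ℝ)) (cotModel E) (extChartAt (cotModel E) α).symm y (v 0))) =
      y.2 (v 0).1
  rw [tderiv_base_extChartAt_symm α hy]
  exact congrArg (fun L : E →L[ℝ] ℝ => L (v 0).1) h2

/-- In the chart centred at `α`, the canonical form is the standard symplectic form. -/
theorem canonicalForm_apply (α : Cotangent E H) (u v : E × (E →L[ℝ] ℝ)) :
    (canonicalForm E H α : (E × (E →L[ℝ] ℝ)) [⋀^Fin 2]→L[ℝ] ℝ) ![u, v] = v.2 u.1 - u.2 v.1 := by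
  have := isManifold_cotangent E H
  -- The form `p dq` depends linearly on the point, so it is its own derivative and `dθ` can be read
  -- off.
  let T : E × (E →L[ℝ] ℝ) →L[ℝ] (E × (E →L[ℝ] ℝ)) [⋀^Fin 1]→L[ℝ] ℝ :=
    (ContinuousAlternatingMap.ofSubsingletonLIE (𝕜 := ℝ) (E := E × (E →L[ℝ] ℝ)) (F := ℝ)
      (0 : Fin 1)).toContinuousLinearEquiv.toContinuousLinearMap ∘L ((ContinuousLinearMap.compL ℝ (E × (E →L[ℝ] ℝ)) E ℝ).flip
        (ContinuousLinearMap.fst ℝ E (E →L[ℝ] ℝ))) ∘L ContinuousLinearMap.snd ℝ E (E →L[ℝ] ℝ)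
  have he : DiffForm.inChart (cotModel E) (tautologicalForm E H) α
      =ᶠ[𝓝 (extChartAt (cotModel E) α α)] T := by
    filter_upwards [extChartAt_target_mem_nhds (I := cotModel E) α] with z hz
    exact tautologicalForm_inChart α hz
  have h1 : (canonicalForm E H α : (E × (E →L[ℝ] ℝ)) [⋀^Fin 2]→L[ℝ] ℝ) ![u, v] =
      - extDeriv (DiffForm.inChart (cotModel E) (tautologicalForm E H) α)
        (extChartAt (cotModel E) α α)
        (fun i => tderiv (cotModel E) 𝓘(ℝ, E × (E →L[ℝ] ℝ)) (extChartAt (cotModel E) α) α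
          (![u, v] i)) := rfl
  rw [h1, tderiv_extChartAt_self, he.extDeriv_eq, extDeriv_apply T.differentiableAt]
  have hT : ∀ w : Fin 1 → E × (E →L[ℝ] ℝ), ∀ z, fderiv ℝ (fun y => T y w)
      (extChartAt (cotModel E) α α) z = z.2 (w 0).1 := by
    intro w z
    have : (fun y => T y w) = fun y : E × (E →L[ℝ] ℝ) => y.2 (w 0).1 := rfl
    rw [this]
    have := (((ContinuousLinearMap.apply ℝ ℝ (w 0).1) ∘L
      (ContinuousLinearMap.snd ℝ E (E →L[ℝ] ℝ))).hasFDerivAt (x := extChartAt (cotModel E) α α))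
    exact congrArg (fun L : E × (E →L[ℝ] ℝ) →L[ℝ] ℝ => L z) this.fderiv
  simp only [hT]
  simp [Fin.removeNth, Fin.sum_univ_two, sub_eq_add_neg]

end Cotangent

/-- A basis of `E` identifies `E →L[ℝ] F` with a finite power of `F`, where differentiability is
checked componentwise. -/
theorem differentiableAt_of_clm_apply {D E F : Type*} [NormedAddCommGroup D] [NormedSpace ℝ D]
    [NormedAddCommGroup E] [NormedSpace ℝ E] [FiniteDimensional ℝ E]
    [NormedAddCommGroup F] [NormedSpace ℝ F] {f : D → E →L[ℝ] F} {x : D}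
    (h : ∀ v, DifferentiableAt ℝ (fun y => f y v) x) : DifferentiableAt ℝ f x := by
  let d := Module.finrank ℝ E
  have hd : d = Module.finrank ℝ (Fin d → ℝ) := (Module.finrank_fin_fun ℝ).symm
  let e₁ := ContinuousLinearEquiv.ofFinrankEq hd
  let e₂ := (e₁.arrowCongr (1 : F ≃L[ℝ] F)).trans (ContinuousLinearEquiv.piRing (Fin d))
  rw [← Function.id_comp f, ← e₂.symm_comp_self]
  exact e₂.symm.differentiableAt.comp x (differentiableAt_pi.2 fun i => h _)

/-! ### The momentum map of left translations -/

section Momentum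

open Filter Topology

variable {E : Type*} [NormedAddCommGroup E] [NormedSpace ℝ E]
  {H : Type*} [TopologicalSpace H] [ChartedSpace E H] [Group H] [LieGroup 𝓘(ℝ, E) ∞ H]

/-- The map `T^*H → 𝔥^*`, `α_g ↦ T^*L_g α_g`. -/
def leftMomentum (α : Cotangent E H) : LieDual E := α.covector.comp (leftTrans α.1)

/-- `leftField` as a map with values in the linear maps `E → E`. -/
def leftFieldL (g : H) (y : E) : E →L[ℝ] E :=
  (tderiv 𝓘(ℝ, E) 𝓘(ℝ, E) (extChartAt 𝓘(ℝ, E) g) ((extChartAt 𝓘(ℝ, E) g).symm y)).comp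
    (leftTrans ((extChartAt 𝓘(ℝ, E) g).symm y))

/-- The derivative of the chart inside `leftFieldL` cancels that of the inverse chart inside the
coordinate `p`. The momentum thus becomes a product of `p` and a function of `q`, ready for the
product rule. -/
theorem leftMomentum_eventuallyEq (α : Cotangent E H) :
    leftMomentum =ᶠ[𝓝 α] fun β => (extChartAt (cotModel E) α β).2.comp
      (leftFieldL α.1 (extChartAt (cotModel E) α β).1) := by
  have := isManifold_one_of_lieGroup E H
  filter_upwards [extChartAt_source_mem_nhds (I := cotModel E) α] with β hβ
  have hβ1 := base_mem_source_of_mem_source hβ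
  have hβ2 : β.1 ∈ (extChartAt 𝓘(ℝ, E) α.1).source := by rwa [extChartAt_source]
  rw [extChartAt_cotangent _ _ hβ1]
  have h := tderiv_extChartAt_symm_comp (I := 𝓘(ℝ, E)) ((extChartAt 𝓘(ℝ, E) α.1).map_source hβ2)
  rw [(extChartAt 𝓘(ℝ, E) α.1).left_inv hβ2] at h
  unfold leftMomentum leftFieldL
  dsimp only
  rw [(extChartAt 𝓘(ℝ, E) α.1).left_inv hβ2]
  ext ξ
  have h2 := congrArg (fun L : E →L[ℝ] E => β.covector (L (leftTrans β.1 ξ))) h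
  exact h2.symm

variable [FiniteDimensional ℝ E]

theorem differentiableAt_leftFieldL (g : H) :
    DifferentiableAt ℝ (leftFieldL (E := E) g) (extChartAt 𝓘(ℝ, E) g g) := by
  have : CompleteSpace E := FiniteDimensional.complete ℝ E
  exact differentiableAt_of_clm_apply fun ξ => differentiableAt_leftField g ξ

omit [FiniteDimensional ℝ E] in
theorem extChartAt_cotangent_self (α : Cotangent E H) :
    extChartAt (cotModel E) α α = (extChartAt 𝓘(ℝ, E) α.1 α.1, α.covector) := by
  have := isManifold_one_of_lieGroup E H
  rw [extChartAt_cotangent _ _ (mem_chart_source E α.1)]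
  rw [tderiv_extChartAt_symm_self, ContinuousLinearMap.comp_id]

theorem hasFDerivAt_comp_leftFieldL (α : Cotangent E H) :
    HasFDerivAt (fun z : E × (E →L[ℝ] ℝ) => z.2.comp (leftFieldL α.1 z.1))
      (((ContinuousLinearMap.compL ℝ E E ℝ α.covector) ∘L
          (fderiv ℝ (leftFieldL α.1) (extChartAt 𝓘(ℝ, E) α.1 α.1)) ∘L
            ContinuousLinearMap.fst ℝ E (E →L[ℝ] ℝ)) +
        ((ContinuousLinearMap.compL ℝ E E ℝ).flip (leftTrans α.1)) ∘L
          ContinuousLinearMap.snd ℝ E (E →L[ℝ] ℝ))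
      (extChartAt (cotModel E) α α) := by
  rw [extChartAt_cotangent_self]
  have h1 : HasFDerivAt (fun z : E × (E →L[ℝ] ℝ) => leftFieldL α.1 z.1) _
      (extChartAt 𝓘(ℝ, E) α.1 α.1, α.covector) :=
    HasFDerivAt.comp (f := Prod.fst) (g := leftFieldL α.1) (extChartAt 𝓘(ℝ, E) α.1 α.1, α.covector)
      (differentiableAt_leftFieldL α.1).hasFDerivAt hasFDerivAt_fst
  have h2 := (hasFDerivAt_snd (𝕜 := ℝ) (p := (extChartAt 𝓘(ℝ, E) α.1 α.1, α.covector))).clm_comp h1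
  have h3 : leftFieldL α.1 (extChartAt 𝓘(ℝ, E) α.1 α.1) = leftTrans α.1 := by
    ext ξ
    exact leftField_center α.1 ξ
  dsimp only at h2
  rw [h3] at h2
  exact h2

theorem mdifferentiableAt_leftMomentum (α : Cotangent E H) :
    MDifferentiableAt (cotModel E) 𝓘(ℝ, LieDual E) leftMomentum α := by
  have := isManifold_cotangent E H
  refine MDifferentiableAt.congr_of_eventuallyEq ?_ (leftMomentum_eventuallyEq α)
  exact (hasFDerivAt_comp_leftFieldL α).differentiableAt.mdifferentiableAt.comp α
    (mdifferentiableAt_extChartAt (mem_chart_source _ α))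

theorem tderiv_leftMomentum (α : Cotangent E H) (u : E × (E →L[ℝ] ℝ)) (ξ : E) :
    tderiv (cotModel E) 𝓘(ℝ, LieDual E) leftMomentum α u ξ =
      α.covector (fderiv ℝ (leftField α.1 ξ) (extChartAt 𝓘(ℝ, E) α.1 α.1) u.1) +
        u.2 (leftTrans α.1 ξ) := by
  have := isManifold_cotangent E H
  have h1 : fderiv ℝ (leftField α.1 ξ) (extChartAt 𝓘(ℝ, E) α.1 α.1) u.1 =
      fderiv ℝ (leftFieldL α.1) (extChartAt 𝓘(ℝ, E) α.1 α.1) u.1 ξ := by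
    have h := ((ContinuousLinearMap.apply ℝ E ξ).hasFDerivAt.comp _
      (differentiableAt_leftFieldL α.1).hasFDerivAt).fderiv
    exact congrArg (fun L : E →L[ℝ] E => L u.1) h
  rw [(leftMomentum_eventuallyEq α).tderiv_eq, tderiv_comp_apply (I' := 𝓘(ℝ, E × (E →L[ℝ] ℝ))) α
    (g := fun z : E × (E →L[ℝ] ℝ) => z.2.comp (leftFieldL α.1 z.1))
    (hasFDerivAt_comp_leftFieldL α).differentiableAt.mdifferentiableAt
    (mdifferentiableAt_extChartAt (mem_chart_source _ α)), tderiv_extChartAt_self,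
    tderiv_eq_fderiv, (hasFDerivAt_comp_leftFieldL α).fderiv, h1]
  rfl

/-- The canonical form in the left trivialisation `T^*H = H × 𝔥^*`. -/
theorem canonicalForm_leftTrans (α : Cotangent E H) (u v : E × (E →L[ℝ] ℝ)) (ξ η : E)
    (hu : u.1 = leftTrans α.1 ξ) (hv : v.1 = leftTrans α.1 η) :
    (canonicalForm E H α : (E × (E →L[ℝ] ℝ)) [⋀^Fin 2]→L[ℝ] ℝ) ![u, v] =
      tderiv (cotModel E) 𝓘(ℝ, LieDual E) leftMomentum α v ξ -
      tderiv (cotModel E) 𝓘(ℝ, LieDual E) leftMomentum α u η +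
      leftMomentum α (lieBr H ξ η) := by
  have : CompleteSpace E := FiniteDimensional.complete ℝ E
  have h : leftMomentum α (lieBr H ξ η) = α.covector (leftTrans α.1 (lieBr H ξ η)) := rfl
  -- The derivatives of the left-invariant fields contributed by the two momentum terms cancel
  -- against the bracket.
  rw [canonicalForm_apply, h, leftTrans_lieBr, tderiv_leftMomentum, tderiv_leftMomentum, map_sub,
    ← hu, ← hv]
  ring

end Momentum

/-! ### The derivative of the adjoint action -/

section Adjoint

open Filter Topology

/-- Derivative at `e` of `y ↦ ∂₂c(y, e) η`, for a local group law `m` around `e` and the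
conjugation `c(y, z) = y⁻¹ z y`. -/
theorem fderiv_conjugation {E : Type*} [NormedAddCommGroup E] [NormedSpace ℝ E] {m c : E × E → E}
    {e : E} (hm : ContDiffAt ℝ 2 m (e, e)) (hc : ContDiffAt ℝ 2 c (e, e))
    (h : ∀ᶠ z in 𝓝 (e, e), m (z.1, c z) = m (z.2, z.1)) (hce : ∀ᶠ y in 𝓝 e, c (y, e) = e)
    (hec : ∀ᶠ z in 𝓝 e, c (e, z) = z) (hme : ∀ᶠ z in 𝓝 e, m (e, z) = z) (η : E) :
    DifferentiableAt ℝ (fun y => fderiv ℝ c (y, e) (0, η)) e ∧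
    ∀ ξ, fderiv ℝ (fun y => fderiv ℝ c (y, e) (0, η)) e ξ =
      fderiv ℝ (fun y => fderiv ℝ m (y, e) (0, ξ)) e η -
      fderiv ℝ (fun y => fderiv ℝ m (y, e) (0, η)) e ξ := by
  have hm' : DifferentiableAt ℝ (fderiv ℝ m) (e, e) :=
    (hm.fderiv_right (m := 1) (by norm_num)).differentiableAt one_ne_zero
  have hc' : DifferentiableAt ℝ (fderiv ℝ c) (e, e) :=
    (hc.fderiv_right (m := 1) (by norm_num)).differentiableAt one_ne_zero
  have hL : HasFDerivAt (fun y : E => (y, e)) (ContinuousLinearMap.inl ℝ E E) e :=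
    (hasFDerivAt_id e).prodMk (hasFDerivAt_const e e)
  have hR : HasFDerivAt (fun y : E => (e, y)) (ContinuousLinearMap.inr ℝ E E) e :=
    (hasFDerivAt_const e e).prodMk (hasFDerivAt_id e)
  have hml : HasFDerivAt (fun y => fderiv ℝ m (y, e))
      ((fderiv ℝ (fderiv ℝ m) (e, e)).comp (ContinuousLinearMap.inl ℝ E E)) e :=
    HasFDerivAt.comp (f := fun y : E => (y, e)) e hm'.hasFDerivAt hL
  have hmr : HasFDerivAt (fun y => fderiv ℝ m (e, y))
      ((fderiv ℝ (fderiv ℝ m) (e, e)).comp (ContinuousLinearMap.inr ℝ E E)) e :=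
    HasFDerivAt.comp (f := fun y : E => (e, y)) e hm'.hasFDerivAt hR
  have hcl : DifferentiableAt ℝ (fun y => fderiv ℝ c (y, e)) e :=
    DifferentiableAt.comp (f := fun y : E => (y, e)) e hc' hL.differentiableAt
  have ha : DifferentiableAt ℝ (fun y => fderiv ℝ c (y, e) (0, η)) e :=
    hcl.clm_apply (differentiableAt_const _)
  refine ⟨ha, fun ξ => ?_⟩
  have hl : ∀ ζ θ, fderiv ℝ (fun y => fderiv ℝ m (y, e) (0, ζ)) e θ =
      fderiv ℝ (fderiv ℝ m) (e, e) (θ, 0) (0, ζ) := by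
    intro ζ θ
    have := (hml.clm_apply (hasFDerivAt_const (0, ζ) e)).fderiv
    rw [this]
    simp
  have hsymm : fderiv ℝ (fderiv ℝ m) (e, e) (η, 0) (0, ξ) =
      fderiv ℝ (fderiv ℝ m) (e, e) (0, ξ) (η, 0) :=
    (hm.isSymmSndFDerivAt (by simp)).eq _ _
  have hma : fderiv ℝ m (e, e) (0, fderiv ℝ (fun y => fderiv ℝ c (y, e) (0, η)) e ξ) =
      fderiv ℝ (fun y => fderiv ℝ c (y, e) (0, η)) e ξ := by
    have h1 : HasFDerivAt (fun y => m (e, y)) _ e := HasFDerivAt.comp (f := fun y : E => (e, y)) e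
      (hm.differentiableAt two_ne_zero).hasFDerivAt hR
    have h2 := h1.unique ((hasFDerivAt_id e).congr_of_eventuallyEq hme)
    exact congrArg (fun L : E →L[ℝ] E => L _) h2
  have hca : fderiv ℝ c (e, e) (0, η) = η := by
    have h1 : HasFDerivAt (fun y => c (e, y)) _ e := HasFDerivAt.comp (f := fun y : E => (e, y)) e
      (hc.differentiableAt two_ne_zero).hasFDerivAt hR
    have h2 := h1.unique ((hasFDerivAt_id e).congr_of_eventuallyEq hec)
    exact congrArg (fun L : E →L[ℝ] E => L η) h2
  have hmd : ∀ᶠ z in 𝓝 (e, e), DifferentiableAt ℝ m z :=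
    (hm.eventually (by simp)).mono fun z hz => hz.differentiableAt two_ne_zero
  have hcd : ∀ᶠ z in 𝓝 (e, e), DifferentiableAt ℝ c z :=
    (hc.eventually (by simp)).mono fun z hz => hz.differentiableAt two_ne_zero
  -- Differentiate `m(y, c(y, z)) = m(z, y)` in `z` at `e`. A further derivative in `y` then
  -- expresses that of `∂₂c` by mixed second derivatives of `m`, whose symmetry gives the
  -- commutator.
  have key : (fun y => fderiv ℝ m (y, e) (0, fderiv ℝ c (y, e) (0, η))) =ᶠ[𝓝 e]
      fun y => fderiv ℝ m (e, y) (η, 0) := by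
    filter_upwards [hL.continuousAt.eventually hmd, hR.continuousAt.eventually hmd,
      hL.continuousAt.eventually hcd, hL.continuousAt.eventually h.eventually_nhds, hce]
      with y h1 h2 h3 h4 h5
    have h6 : HasFDerivAt (fun z : E × E => (z.1, c z))
        ((ContinuousLinearMap.fst ℝ E E).prod (fderiv ℝ c (y, e))) (y, e) :=
      hasFDerivAt_fst.prodMk h3.hasFDerivAt
    have h7 : HasFDerivAt (fun z : E × E => (z.2, z.1))
        ((ContinuousLinearMap.snd ℝ E E).prod (ContinuousLinearMap.fst ℝ E E)) (y, e) :=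
      hasFDerivAt_snd.prodMk hasFDerivAt_fst
    have h8 : HasFDerivAt m (fderiv ℝ m (y, e)) (y, c (y, e)) := by
      rw [h5]; exact h1.hasFDerivAt
    have h9 := HasFDerivAt.comp (f := fun z : E × E => (z.1, c z)) (y, e) h8 h6
    have h10 := HasFDerivAt.comp (f := fun z : E × E => (z.2, z.1)) (y, e) h2.hasFDerivAt h7
    have h11 := h9.unique (h10.congr_of_eventuallyEq h4)
    exact congrArg (fun L : E × E →L[ℝ] E => L (0, η)) h11
  have h1 : HasFDerivAt (fun y => fderiv ℝ m (y, e) (0, fderiv ℝ c (y, e) (0, η))) _ e :=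
    hml.clm_apply ((hasFDerivAt_const (0 : E) e).prodMk ha.hasFDerivAt)
  have h2 : HasFDerivAt (fun y => fderiv ℝ m (e, y) (η, 0)) _ e :=
    hmr.clm_apply (hasFDerivAt_const (η, (0 : E)) e)
  have h3 := congrArg (fun L : E →L[ℝ] E => L ξ) (h1.unique (h2.congr_of_eventuallyEq key))
  simp only [add_apply, ContinuousLinearMap.comp_apply,
    ContinuousLinearMap.flip_apply, ContinuousLinearMap.prod_apply, ContinuousLinearMap.inl_apply,
    ContinuousLinearMap.inr_apply, zero_apply, map_zero, zero_add] at h3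
  rw [hma, hca] at h3
  rw [hl, hl, hsymm, ← h3, add_sub_cancel_right]

variable {E : Type*} [NormedAddCommGroup E] [NormedSpace ℝ E]
  {H : Type*} [TopologicalSpace H] [ChartedSpace E H] [Group H] [LieGroup 𝓘(ℝ, E) ∞ H]

variable (H) in
/-- The group law in the chart centred at the identity. -/
def chartMul (z : E × E) : E :=
  extChartAt 𝓘(ℝ, E) (1 : H)
    ((extChartAt 𝓘(ℝ, E) (1 : H)).symm z.1 * (extChartAt 𝓘(ℝ, E) (1 : H)).symm z.2)

variable (H) in
/-- The conjugation `(y, z) ↦ y⁻¹ z y` in the chart centred at the identity. -/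
def chartConj (z : E × E) : E :=
  extChartAt 𝓘(ℝ, E) (1 : H)
    (((extChartAt 𝓘(ℝ, E) (1 : H)).symm z.1)⁻¹ * (extChartAt 𝓘(ℝ, E) (1 : H)).symm z.2 *
      (extChartAt 𝓘(ℝ, E) (1 : H)).symm z.1)

theorem contMDiffAt_symm_fst :
    ContMDiffAt 𝓘(ℝ, E × E) 𝓘(ℝ, E) 2 (fun z : E × E => (extChartAt 𝓘(ℝ, E) (1 : H)).symm z.1)
      (extChartAt 𝓘(ℝ, E) (1 : H) 1, extChartAt 𝓘(ℝ, E) (1 : H) 1) := by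
  have : IsManifold 𝓘(ℝ, E) ∞ H := inferInstance
  have : IsManifold 𝓘(ℝ, E) 2 H := IsManifold.of_le (n := ∞) ENat.LEInfty.out
  have h := contMDiffOn_extChartAt_symm (I := 𝓘(ℝ, E)) (n := 2) (1 : H)
  exact ContMDiffAt.comp (I' := 𝓘(ℝ, E)) (f := Prod.fst)
    (extChartAt 𝓘(ℝ, E) (1 : H) 1, extChartAt 𝓘(ℝ, E) (1 : H) 1)
    (h.contMDiffAt (extChartAt_target_mem_nhds (I := 𝓘(ℝ, E)) (1 : H)))
    contDiff_fst.contMDiff.contMDiffAt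

theorem contMDiffAt_symm_snd :
    ContMDiffAt 𝓘(ℝ, E × E) 𝓘(ℝ, E) 2 (fun z : E × E => (extChartAt 𝓘(ℝ, E) (1 : H)).symm z.2)
      (extChartAt 𝓘(ℝ, E) (1 : H) 1, extChartAt 𝓘(ℝ, E) (1 : H) 1) := by
  have : IsManifold 𝓘(ℝ, E) ∞ H := inferInstance
  have : IsManifold 𝓘(ℝ, E) 2 H := IsManifold.of_le (n := ∞) ENat.LEInfty.out
  have h := contMDiffOn_extChartAt_symm (I := 𝓘(ℝ, E)) (n := 2) (1 : H)
  exact ContMDiffAt.comp (I' := 𝓘(ℝ, E)) (f := Prod.snd)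
    (extChartAt 𝓘(ℝ, E) (1 : H) 1, extChartAt 𝓘(ℝ, E) (1 : H) 1)
    (h.contMDiffAt (extChartAt_target_mem_nhds (I := 𝓘(ℝ, E)) (1 : H)))
    contDiff_snd.contMDiff.contMDiffAt

variable (E H) in
theorem lieGroup_two : LieGroup 𝓘(ℝ, E) 2 H :=
  LieGroup.of_le (n := ∞) ENat.LEInfty.out

theorem contDiffAt_chartMul : ContDiffAt ℝ 2 (chartMul (E := E) H)
    (extChartAt 𝓘(ℝ, E) (1 : H) 1, extChartAt 𝓘(ℝ, E) (1 : H) 1) := by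
  have : IsManifold 𝓘(ℝ, E) ∞ H := inferInstance
  have : IsManifold 𝓘(ℝ, E) 2 H := IsManifold.of_le (n := ∞) ENat.LEInfty.out
  have := lieGroup_two E H
  rw [← contMDiffAt_iff_contDiffAt]
  refine ContMDiffAt.comp_of_eq (y := (1 : H)) (contMDiffAt_extChartAt (I := 𝓘(ℝ, E)))
    (contMDiffAt_symm_fst.mul contMDiffAt_symm_snd) ?_
  simp

theorem contDiffAt_chartConj : ContDiffAt ℝ 2 (chartConj (E := E) H)
    (extChartAt 𝓘(ℝ, E) (1 : H) 1, extChartAt 𝓘(ℝ, E) (1 : H) 1) := by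
  have : IsManifold 𝓘(ℝ, E) ∞ H := inferInstance
  have : IsManifold 𝓘(ℝ, E) 2 H := IsManifold.of_le (n := ∞) ENat.LEInfty.out
  have := lieGroup_two E H
  rw [← contMDiffAt_iff_contDiffAt]
  refine ContMDiffAt.comp_of_eq (y := (1 : H)) (contMDiffAt_extChartAt (I := 𝓘(ℝ, E)))
    ((contMDiffAt_symm_fst.inv.mul contMDiffAt_symm_snd).mul contMDiffAt_symm_fst) ?_
  simp

theorem leftField_one_eventuallyEq (ζ : E) :
    leftField (1 : H) ζ =ᶠ[𝓝 (extChartAt 𝓘(ℝ, E) (1 : H) 1)]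
      fun y => fderiv ℝ (chartMul (E := E) H) (y, extChartAt 𝓘(ℝ, E) (1 : H) 1) (0, ζ) := by
  have := isManifold_one_of_lieGroup E H
  have hL : ContinuousAt (fun y : E => (y, extChartAt 𝓘(ℝ, E) (1 : H) 1))
    (extChartAt 𝓘(ℝ, E) (1 : H) 1) := by fun_prop
  filter_upwards [extChartAt_target_mem_nhds (I := 𝓘(ℝ, E)) (1 : H),
    hL.eventually (contDiffAt_chartMul (E := E) (H := H) |>.eventually (by simp))] with y hy hd
  set s := (extChartAt 𝓘(ℝ, E) (1 : H)).symm y with hs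
  have hs1 : s ∈ (chartAt E (1 : H)).source := by
    rw [← extChartAt_source 𝓘(ℝ, E)]
    exact (extChartAt 𝓘(ℝ, E) (1 : H)).map_target hy
  have hmd : MDifferentiableAt 𝓘(ℝ, E) 𝓘(ℝ, E) (extChartAt 𝓘(ℝ, E) (1 : H)) (s * 1) := by
    rw [mul_one]
    exact mdifferentiableAt_extChartAt hs1
  have h1 : leftField (1 : H) ζ y =
      tderiv 𝓘(ℝ, E) 𝓘(ℝ, E) (fun h => extChartAt 𝓘(ℝ, E) (1 : H) (s * h)) 1 ζ := by
    rw [tderiv_comp_apply (I' := 𝓘(ℝ, E)) (1 : H) hmd (mdifferentiableAt_leftMul s 1), mul_one]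
    rfl
  have hmd' : MDifferentiableAt 𝓘(ℝ, E) 𝓘(ℝ, E) (fun h => extChartAt 𝓘(ℝ, E) (1 : H) (s * h)) 1 :=
    hmd.comp (1 : H) (mdifferentiableAt_leftMul s 1)
  rw [h1, tderiv_eq_fderiv_extChartAt hmd']
  have h2 : HasFDerivAt (fun z => chartMul H (y, z)) _ (extChartAt 𝓘(ℝ, E) (1 : H) 1) :=
    HasFDerivAt.comp (f := fun z : E => (y, z)) _ (hd.differentiableAt two_ne_zero).hasFDerivAt
    ((hasFDerivAt_const y _).prodMk (hasFDerivAt_id _))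
  exact congrArg (fun L : E →L[ℝ] E => L ζ) h2.fderiv

theorem lieAd_inv_eventuallyEq (η : E) :
    (fun g : H => lieAd g⁻¹ η) =ᶠ[𝓝 1] fun g => fderiv ℝ (chartConj (E := E) H)
      (extChartAt 𝓘(ℝ, E) (1 : H) g, extChartAt 𝓘(ℝ, E) (1 : H) 1) (0, η) := by
  have := isManifold_one_of_lieGroup E H
  have hL : ContinuousAt (fun g : H => (extChartAt 𝓘(ℝ, E) (1 : H) g,
      extChartAt 𝓘(ℝ, E) (1 : H) 1)) 1 :=
    (continuousAt_extChartAt (I := 𝓘(ℝ, E)) (1 : H)).prodMk continuousAt_const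
  filter_upwards [extChartAt_source_mem_nhds (I := 𝓘(ℝ, E)) (1 : H),
    hL.eventually (contDiffAt_chartConj (E := E) (H := H) |>.eventually (by simp))] with g hg hd
  have hmd : MDifferentiableAt 𝓘(ℝ, E) 𝓘(ℝ, E) (fun h : H => g⁻¹ * h * g⁻¹⁻¹) 1 := by
    have h : ContMDiff 𝓘(ℝ, E) 𝓘(ℝ, E) ∞ (fun h : H => g⁻¹ * h * g⁻¹⁻¹) :=
      (contMDiff_const.mul contMDiff_id).mul contMDiff_const
    exact h.mdifferentiable (by simp) 1
  have h1 : lieAd g⁻¹ = tderiv 𝓘(ℝ, E) 𝓘(ℝ, E) (fun h : H => g⁻¹ * h * g⁻¹⁻¹) 1 := rfl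
  have h0 : g⁻¹ * 1 * g⁻¹⁻¹ = 1 := by simp
  rw [h1, tderiv_eq_fderiv_extChartAt hmd, h0]
  have h2 : HasFDerivAt (fun z => chartConj H (extChartAt 𝓘(ℝ, E) (1 : H) g, z)) _
      (extChartAt 𝓘(ℝ, E) (1 : H) 1) :=
    HasFDerivAt.comp (f := fun z : E => (extChartAt 𝓘(ℝ, E) (1 : H) g, z)) _
      (hd.differentiableAt two_ne_zero).hasFDerivAt
      ((hasFDerivAt_const _ _).prodMk (hasFDerivAt_id _))
  unfold chartConj at h2
  simp only [(extChartAt 𝓘(ℝ, E) (1 : H)).left_inv hg] at h2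
  rw [inv_inv]
  exact congrArg (fun L : E →L[ℝ] E => L η) h2.fderiv

/-- In the chart at the identity, `Ad_{g⁻¹} η` is `∂₂c(y, e) η` and the left-invariant field of `ζ`
is `∂₂m(y, e) ζ`. So `fderiv_conjugation` and `leftTrans_lieBr` evaluate the same commutator with
opposite signs. -/
theorem hasDeriv_lieAd_inv [FiniteDimensional ℝ E] (η : E) :
    MDifferentiableAt 𝓘(ℝ, E) 𝓘(ℝ, E) (fun g : H => lieAd g⁻¹ η) 1 ∧
    ∀ ξ, tderiv 𝓘(ℝ, E) 𝓘(ℝ, E) (fun g : H => lieAd g⁻¹ η) 1 ξ = - lieBr H ξ η := by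
  have : CompleteSpace E := FiniteDimensional.complete ℝ E
  have := isManifold_one_of_lieGroup E H
  set e := extChartAt 𝓘(ℝ, E) (1 : H) 1 with he
  have h1 : ContinuousAt (fun y : E => (extChartAt 𝓘(ℝ, E) (1 : H)).symm y) e :=
    continuousAt_extChartAt_symm (I := 𝓘(ℝ, E)) (1 : H)
  have htarget := extChartAt_target_mem_nhds (I := 𝓘(ℝ, E)) (1 : H)
  have hsource := extChartAt_source_mem_nhds (I := 𝓘(ℝ, E)) (1 : H)
  have hse : (extChartAt 𝓘(ℝ, E) (1 : H)).symm e = 1 := extChartAt_to_inv 1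
  have hcalc := fderiv_conjugation (e := e) (contDiffAt_chartMul (E := E) (H := H))
    (contDiffAt_chartConj (E := E) (H := H)) ?_ ?_ ?_ ?_ η
  rotate_left
  -- The identity `s (s⁻¹ t s) = t s` passes to the chart only where `s⁻¹ t s` lies in the chart
  -- domain, hence the continuity argument.
  · have hcont : ContinuousAt (fun z : E × E => ((extChartAt 𝓘(ℝ, E) (1 : H)).symm z.1)⁻¹ *
      (extChartAt 𝓘(ℝ, E) (1 : H)).symm z.2 * (extChartAt 𝓘(ℝ, E) (1 : H)).symm z.1) (e, e) :=
      ((contMDiffAt_symm_fst.inv.mul contMDiffAt_symm_snd).mul contMDiffAt_symm_fst).continuousAt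
    have hval : ((extChartAt 𝓘(ℝ, E) (1 : H)).symm e)⁻¹ * (extChartAt 𝓘(ℝ, E) (1 : H)).symm e *
      (extChartAt 𝓘(ℝ, E) (1 : H)).symm e = 1 := by simp [e]
    rw [← hval] at hsource
    filter_upwards [hcont hsource] with z hz
    change extChartAt 𝓘(ℝ, E) (1 : H) ((extChartAt 𝓘(ℝ, E) (1 : H)).symm z.1 *
      (extChartAt 𝓘(ℝ, E) (1 : H)).symm (extChartAt 𝓘(ℝ, E) (1 : H) _)) = extChartAt 𝓘(ℝ, E) (1 : H) _
    rw [hval] at hz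
    rw [(extChartAt 𝓘(ℝ, E) (1 : H)).left_inv hz, ← mul_assoc, mul_inv_cancel_left]
  · filter_upwards with y
    unfold chartConj
    dsimp only
    rw [hse, mul_one, inv_mul_cancel]
  · filter_upwards [htarget] with z hz
    unfold chartConj
    dsimp only
    rw [hse, inv_one, one_mul, mul_one, (extChartAt 𝓘(ℝ, E) (1 : H)).right_inv hz]
  · filter_upwards [htarget] with z hz
    unfold chartMul
    dsimp only
    rw [hse, one_mul, (extChartAt 𝓘(ℝ, E) (1 : H)).right_inv hz]
  obtain ⟨hd, hf⟩ := hcalc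
  have hmd : MDifferentiableAt 𝓘(ℝ, E) 𝓘(ℝ, E) (extChartAt 𝓘(ℝ, E) (1 : H)) 1 :=
    mdifferentiableAt_extChartAt (mem_chart_source E (1 : H))
  refine ⟨MDifferentiableAt.congr_of_eventuallyEq (hd.mdifferentiableAt.comp (1 : H) hmd)
    (lieAd_inv_eventuallyEq η), fun ξ => ?_⟩
  have h2 := leftTrans_lieBr (1 : H) ξ η
  rw [(leftField_one_eventuallyEq η).fderiv_eq, (leftField_one_eventuallyEq ξ).fderiv_eq,
    leftTrans_one] at h2
  rw [(lieAd_inv_eventuallyEq η).tderiv_eq]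
  refine (tderiv_comp_apply (I' := 𝓘(ℝ, E)) (1 : H)
    (g := fun y => fderiv ℝ (chartConj H) (y, e) (0, η)) (f := extChartAt 𝓘(ℝ, E) (1 : H))
    hd.mdifferentiableAt hmd ξ).trans ?_
  rw [tderiv_extChartAt_self, tderiv_eq_fderiv]
  refine (hf ξ).trans ?_
  rw [← neg_sub]
  exact congrArg Neg.neg h2.symm

end Adjoint

/-! ### Two-forms as bilinear forms on the model space -/

section Bilin

variable {E : Type*} [NormedAddCommGroup E] [NormedSpace ℝ E]
  {K : Type*} [TopologicalSpace K] {I : ModelWithCorners ℝ E K}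
  {M : Type*} [TopologicalSpace M] [ChartedSpace K M]
  {E' : Type*} [NormedAddCommGroup E'] [NormedSpace ℝ E']
  {K' : Type*} [TopologicalSpace K'] {I' : ModelWithCorners ℝ E' K'}
  {M' : Type*} [TopologicalSpace M'] [ChartedSpace K' M']

/-- A continuous alternating map in two variables, as a bilinear map. -/
def ContinuousAlternatingMap.toBilin (f : E [⋀^Fin 2]→L[ℝ] ℝ) : E →ₗ[ℝ] E →ₗ[ℝ] ℝ :=
  LinearMap.mk₂ ℝ (fun u v => f ![u, v])
    (fun u u' v => congrArg (fun g : E [⋀^Fin 1]→ₗ[ℝ] ℝ => g ![v])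
      (map_add f.toAlternatingMap.curryLeft u u'))
    (fun c u v => congrArg (fun g : E [⋀^Fin 1]→ₗ[ℝ] ℝ => g ![v])
      (map_smul f.toAlternatingMap.curryLeft c u))
    (fun u v v' => congrArg (fun g : E [⋀^Fin 0]→ₗ[ℝ] ℝ => g ![])
      (map_add (f.toAlternatingMap.curryLeft u).curryLeft v v'))
    (fun c u v => congrArg (fun g : E [⋀^Fin 0]→ₗ[ℝ] ℝ => g ![])
      (map_smul (f.toAlternatingMap.curryLeft u).curryLeft c v))

/-- A two-form at the point `x`, as a bilinear map on the model space. -/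
def DiffForm.bilin (om : DiffForm I M 2) (x : M) : E →ₗ[ℝ] E →ₗ[ℝ] ℝ :=
  ContinuousAlternatingMap.toBilin (om x : E [⋀^Fin 2]→L[ℝ] ℝ)

theorem ContinuousAlternatingMap.toBilin_swap (f : E [⋀^Fin 2]→L[ℝ] ℝ) (u v : E) :
    f.toBilin u v = - f.toBilin v u := by
  have h := f.toAlternatingMap.map_swap ![v, u] (i := 0) (j := 1) (by decide)
  have h2 : (![v, u] ∘ Equiv.swap (0 : Fin 2) 1) = ![u, v] := by
    ext i
    fin_cases i <;> simp
  rw [h2] at h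
  exact h

theorem DiffForm.bilin_swap (om : DiffForm I M 2) (x : M) (u v : E) :
    DiffForm.bilin om x u v = - DiffForm.bilin om x v u :=
  ContinuousAlternatingMap.toBilin_swap _ u v

theorem DiffForm.bilin_pullback (f : M → M') (om : DiffForm I' M' 2) (x : M) (u v : E) :
    DiffForm.bilin (DiffForm.pullback I I' f om) x u v =
      DiffForm.bilin om (f x) (tderiv I I' f x u) (tderiv I I' f x v) := by
  have h : (fun i => tderiv I I' f x (![u, v] i)) = ![tderiv I I' f x u, tderiv I I' f x v] := by
    ext i
    fin_cases i <;> rfl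
  exact congrArg (fun w => (om (f x) : E' [⋀^Fin 2]→L[ℝ] ℝ) w) h

theorem DiffForm.IsNondegenerate.bilin {om : DiffForm I M 2}
    (h : DiffForm.IsNondegenerate I om) {x : M} {u : E}
    (hu : ∀ v, DiffForm.bilin om x u v = 0) : u = 0 :=
  h x u hu

end Bilin

/-! ### The diagonal action and the quotient map -/

/-- The derivative at `x` of the action of `g`. -/
def actDeriv {H : Type*} [Group H] (V : Type*) [NormedAddCommGroup V] [NormedSpace ℝ V]
    {P : Type*} [TopologicalSpace P] [ChartedSpace V P] [MulAction H P] (g : H) (x : P) :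
    V →L[ℝ] V := tderiv 𝓘(ℝ, V) 𝓘(ℝ, V) (fun y : P => g • y) x

theorem mdifferentiableAt_smul_right (E : Type*) [NormedAddCommGroup E] [NormedSpace ℝ E]
    {H : Type*} [TopologicalSpace H] [ChartedSpace E H] [Group H]
    (V : Type*) [NormedAddCommGroup V] [NormedSpace ℝ V]
    {P : Type*} [TopologicalSpace P] [ChartedSpace V P] [MulAction H P]
    [ContMDiffSMul 𝓘(ℝ, E) 𝓘(ℝ, V) ∞ H P] (g : H) (x : P) :
    MDifferentiableAt 𝓘(ℝ, V) 𝓘(ℝ, V) (fun y : P => g • y) x :=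
  (ContMDiffSMul.contMDiff_const_smul (I := 𝓘(ℝ, E)) (n := ∞) g).mdifferentiable (by simp) x


section Action

open Filter Topology

variable {E : Type*} [NormedAddCommGroup E] [NormedSpace ℝ E]
  {H : Type*} [TopologicalSpace H] [ChartedSpace E H] [Group H] [LieGroup 𝓘(ℝ, E) ∞ H]
  {V : Type*} [NormedAddCommGroup V] [NormedSpace ℝ V]
  {P : Type*} [TopologicalSpace P] [ChartedSpace V P]
  [MulAction H P]

variable (E H V) in
/-- The infinitesimal action `ξ ↦ ξ_P(x)`. -/
def infAct (x : P) : E →L[ℝ] V := tderiv 𝓘(ℝ, E) 𝓘(ℝ, V) (fun h : H => h • x) 1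

variable [ContMDiffSMul 𝓘(ℝ, E) 𝓘(ℝ, V) ∞ H P]

omit [LieGroup 𝓘(ℝ, E) ∞ H] in
variable (E H V P) in
theorem mdifferentiable_smul :
    MDifferentiable (𝓘(ℝ, E).prod 𝓘(ℝ, V)) 𝓘(ℝ, V) (fun z : H × P => z.1 • z.2) :=
  (contMDiff_smul (I := 𝓘(ℝ, E)) (I' := 𝓘(ℝ, V)) (n := ∞)).mdifferentiable (by simp)

omit [LieGroup 𝓘(ℝ, E) ∞ H] in
variable (E V) in
theorem mdifferentiableAt_smul_left (h : H) (x : P) :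
    MDifferentiableAt 𝓘(ℝ, E) 𝓘(ℝ, V) (fun h : H => h • x) h :=
  (mdifferentiable_smul E H V P).mdifferentiableAt.comp (f := fun h : H => (h, x)) h
    (mdifferentiableAt_id.prodMk mdifferentiableAt_const)

/-- Differentiate `(g h) • x = g • (h • x)` in `h` at the identity. -/
theorem tderiv_smul_left (g : H) (x : P) (ξ : E) :
    tderiv 𝓘(ℝ, E) 𝓘(ℝ, V) (fun h : H => h • x) g (leftTrans g ξ) =
      actDeriv V g x (infAct E H V x ξ) := by
  have h1 := tderiv_comp_apply (I := 𝓘(ℝ, E)) (I' := 𝓘(ℝ, E)) (I'' := 𝓘(ℝ, V)) (1 : H)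
    (f := fun h => g * h) (g := fun h : H => h • x)
    (mdifferentiableAt_smul_left E V (g * 1) x) (mdifferentiableAt_leftMul g 1) ξ
  have h2 := tderiv_comp_apply (I := 𝓘(ℝ, E)) (I' := 𝓘(ℝ, V)) (I'' := 𝓘(ℝ, V)) (1 : H)
    (f := fun h : H => h • x) (g := fun y : P => g • y)
    (mdifferentiableAt_smul_right E V g ((1 : H) • x)) (mdifferentiableAt_smul_left E V 1 x) ξ
  simp only [mul_smul] at h1
  rw [mul_one] at h1
  rw [one_smul] at h2
  exact h1.symm.trans h2

omit [LieGroup 𝓘(ℝ, E) ∞ H] in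
theorem tderiv_smul (g : H) (x : P) (a : E) (b : V) :
    tderiv (𝓘(ℝ, E).prod 𝓘(ℝ, V)) 𝓘(ℝ, V) (fun z : H × P => z.1 • z.2) (g, x) (a, b) =
      tderiv 𝓘(ℝ, E) 𝓘(ℝ, V) (fun h : H => h • x) g a + actDeriv V g x b :=
  mfderiv_prod_eq_add_apply ((mdifferentiable_smul E H V P) (g, x))

theorem tderiv_base (α : Cotangent E H) :
    tderiv (cotModel E) 𝓘(ℝ, E) (fun β : Cotangent E H => β.1) α =
      ContinuousLinearMap.fst ℝ E (E →L[ℝ] ℝ) := by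
  have := isManifold_one_of_lieGroup E H
  have := isManifold_cotangent E H
  refine ContinuousLinearMap.ext fun v => ?_
  have h := tderiv_base_extChartAt_symm α (mem_extChartAt_target α) v
  rw [tderiv_extChartAt_symm_self, extChartAt_to_inv, extChartAt_cotangent_self,
    tderiv_extChartAt_symm_self] at h
  exact h

theorem mdifferentiable_base :
    MDifferentiable (cotModel E) 𝓘(ℝ, E) (fun β : Cotangent E H => β.1) := by
  have := isManifold_one_of_lieGroup E H
  exact (contMDiff_proj (n := 1) _).mdifferentiable one_ne_zero

omit [MulAction H P] [ContMDiffSMul 𝓘(ℝ, E) 𝓘(ℝ, V) ∞ H P] in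
theorem mdifferentiable_base_fst :
    MDifferentiable ((cotModel E).prod 𝓘(ℝ, V)) 𝓘(ℝ, E) (fun z : Cotangent E H × P => z.1.1) :=
  fun z => (mdifferentiable_base z.1).comp z mdifferentiableAt_fst

omit [MulAction H P] [ContMDiffSMul 𝓘(ℝ, E) 𝓘(ℝ, V) ∞ H P] in
theorem tderiv_base_fst (z : Cotangent E H × P) (w : (E × (E →L[ℝ] ℝ)) × V) :
    tderiv ((cotModel E).prod 𝓘(ℝ, V)) 𝓘(ℝ, E) (fun z : Cotangent E H × P => z.1.1) z w =
      w.1.1 := by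
  rw [tderiv_comp_apply z (g := fun β : Cotangent E H => β.1) (mdifferentiable_base z.1)
    mdifferentiableAt_fst, tderiv_fst, tderiv_base]
  rfl

theorem mdifferentiable_inv_smul :
    MDifferentiable ((cotModel E).prod 𝓘(ℝ, V)) 𝓘(ℝ, V)
      (fun z : Cotangent E H × P => z.1.1⁻¹ • z.2) := fun z =>
  ((mdifferentiable_smul E H V P).mdifferentiableAt.comp (f := fun z => (z.1.1⁻¹, z.2)) z
    ((((contMDiff_inv 𝓘(ℝ, E) ∞).mdifferentiable (by simp) z.1.1).comp z
      (mdifferentiable_base_fst z)).prodMk mdifferentiableAt_snd))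

/-- The `P`-component of a tangent vector of `T^*H × P` in terms of the derivative of the quotient
map and the left-trivialised `H`-component `ξ`. -/
theorem snd_eq_actDeriv (z : Cotangent E H × P) (w : (E × (E →L[ℝ] ℝ)) × V) (ξ : E)
    (hξ : w.1.1 = leftTrans z.1.1 ξ) :
    w.2 = actDeriv V z.1.1 (z.1.1⁻¹ • z.2) (infAct E H V (z.1.1⁻¹ • z.2) ξ +
      tderiv ((cotModel E).prod 𝓘(ℝ, V)) 𝓘(ℝ, V)
        (fun z : Cotangent E H × P => z.1.1⁻¹ • z.2) z w) := by
  -- Differentiate `p = g • (g⁻¹ • p)`.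
  have h1 : w.2 = tderiv ((cotModel E).prod 𝓘(ℝ, V)) 𝓘(ℝ, V)
      (fun z : Cotangent E H × P => z.1.1 • (z.1.1⁻¹ • z.2)) z w := by
    simp only [smul_inv_smul]
    exact (congrArg (fun L : (E × (E →L[ℝ] ℝ)) × V →L[ℝ] V => L w) (tderiv_snd z)).symm
  rw [h1, tderiv_comp_apply (I' := 𝓘(ℝ, E).prod 𝓘(ℝ, V)) z (g := fun z : H × P => z.1 • z.2)
    (f := fun z : Cotangent E H × P => (z.1.1, z.1.1⁻¹ • z.2))
    (mdifferentiable_smul E H V P _)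
    ((mdifferentiable_base_fst z).prodMk (mdifferentiable_inv_smul z)),
    tderiv_prodMk (mdifferentiable_base_fst z) (mdifferentiable_inv_smul z),
    ContinuousLinearMap.prod_apply, tderiv_base_fst, tderiv_smul, hξ, tderiv_smul_left, map_add]

end Action

/-! ### Derivatives of functions with values in normed spaces -/

section TDerivReal

variable {E : Type*} [NormedAddCommGroup E] [NormedSpace ℝ E]
  {K : Type*} [TopologicalSpace K] {I : ModelWithCorners ℝ E K}
  {M : Type*} [TopologicalSpace M] [ChartedSpace K M]
  {F : Type*} [NormedAddCommGroup F] [NormedSpace ℝ F]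
  {F' : Type*} [NormedAddCommGroup F'] [NormedSpace ℝ F']

theorem tderiv_neg_add {f g : M → ℝ} {x : M} (hf : MDifferentiableAt I 𝓘(ℝ, ℝ) f x)
    (hg : MDifferentiableAt I 𝓘(ℝ, ℝ) g x) :
    tderiv I 𝓘(ℝ, ℝ) (fun y => - f y + g y) x =
      - tderiv I 𝓘(ℝ, ℝ) f x + tderiv I 𝓘(ℝ, ℝ) g x :=
  (hf.hasMFDerivAt.neg.add hg.hasMFDerivAt).mfderiv

theorem tderiv_sub {f g : M → F} {x : M} (hf : MDifferentiableAt I 𝓘(ℝ, F) f x)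
    (hg : MDifferentiableAt I 𝓘(ℝ, F) g x) :
    tderiv I 𝓘(ℝ, F) (fun y => f y - g y) x = tderiv I 𝓘(ℝ, F) f x - tderiv I 𝓘(ℝ, F) g x :=
  (hf.hasMFDerivAt.sub hg.hasMFDerivAt).mfderiv

theorem tderiv_clm_comp (L : F →L[ℝ] F') {f : M → F} {x : M}
    (hf : MDifferentiableAt I 𝓘(ℝ, F) f x) (v : E) :
    tderiv I 𝓘(ℝ, F') (fun y => L (f y)) x v = L (tderiv I 𝓘(ℝ, F) f x v) := by
  rw [tderiv_comp_apply x L.differentiableAt.mdifferentiableAt hf, tderiv_eq_fderiv,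
    ContinuousLinearMap.fderiv]

theorem mdifferentiableAt_clm_comp (L : F →L[ℝ] F') {f : M → F} {x : M}
    (hf : MDifferentiableAt I 𝓘(ℝ, F) f x) :
    MDifferentiableAt I 𝓘(ℝ, F') (fun y => L (f y)) x :=
  L.differentiableAt.mdifferentiableAt.comp x hf

end TDerivReal

/-! ### The magnetic form in terms of the quotient map -/

section Magnetic

variable {E : Type*} [NormedAddCommGroup E] [NormedSpace ℝ E]
  {H : Type*} [TopologicalSpace H] [ChartedSpace E H] [Group H] [LieGroup 𝓘(ℝ, E) ∞ H]
  {V : Type*} [NormedAddCommGroup V] [NormedSpace ℝ V]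
  {P : Type*} [TopologicalSpace P] [ChartedSpace V P]
  {B : DiffForm (𝓘(ℝ, E).prod 𝓘(ℝ, V)) (H × P) 2}

/-- The magnetic form in the canonical chart. -/
theorem magneticForm_bilin (z : Cotangent E H × P) (u w : (E × (E →L[ℝ] ℝ)) × V) :
    DiffForm.bilin (magneticForm B) z u w =
      DiffForm.bilin (canonicalForm E H) z.1 u.1 w.1 -
        DiffForm.bilin B (z.1.1, z.2) (u.1.1, u.2) (w.1.1, w.2) := by
  have h1 := DiffForm.bilin_pullback (I := (cotModel E).prod 𝓘(ℝ, V)) (I' := cotModel E)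
    (Prod.fst : Cotangent E H × P → Cotangent E H) (canonicalForm E H) z u w
  have h2 := DiffForm.bilin_pullback (I := (cotModel E).prod 𝓘(ℝ, V))
    (I' := 𝓘(ℝ, E).prod 𝓘(ℝ, V)) (fun w : Cotangent E H × P => (w.1.1, w.2)) B z u w
  have h3 : ∀ v, tderiv ((cotModel E).prod 𝓘(ℝ, V)) (𝓘(ℝ, E).prod 𝓘(ℝ, V))
      (fun w : Cotangent E H × P => (w.1.1, w.2)) z v = (v.1.1, v.2) := by
    intro v
    rw [tderiv_prodMk (mdifferentiable_base_fst z) mdifferentiableAt_snd,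
      ContinuousLinearMap.prod_apply, tderiv_base_fst]
    exact congrArg (fun L : (E × (E →L[ℝ] ℝ)) × V →L[ℝ] V => (v.1.1, L v)) (tderiv_snd z)
  rw [tderiv_fst] at h1
  rw [h3, h3] at h2
  exact congrArg₂ (fun a b : ℝ => a - b) h1 h2

omit [Group H] [LieGroup 𝓘(ℝ, E) ∞ H] in
theorem bilin_slice {ωP : DiffForm 𝓘(ℝ, V) P 2}
    (hBP : ∀ g : H, DiffForm.pullback 𝓘(ℝ, V) (𝓘(ℝ, E).prod 𝓘(ℝ, V)) (fun p : P => (g, p)) B = ωP)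
    (g : H) (p : P) (v w : V) :
    DiffForm.bilin B (g, p) (0, v) (0, w) = DiffForm.bilin ωP p v w := by
  have h1 : ∀ v, tderiv 𝓘(ℝ, V) (𝓘(ℝ, E).prod 𝓘(ℝ, V)) (fun p : P => (g, p)) p v = (0, v) := by
    intro v
    have hid : MDifferentiableAt 𝓘(ℝ, V) 𝓘(ℝ, V) (fun p : P => p) p := mdifferentiableAt_id
    rw [tderiv_prodMk mdifferentiableAt_const hid, tderiv_const, tderiv_id]
    rfl
  have h := DiffForm.bilin_pullback (I := 𝓘(ℝ, V)) (I' := 𝓘(ℝ, E).prod 𝓘(ℝ, V))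
    (fun p : P => (g, p)) B p v w
  rw [h1, h1, hBP] at h
  exact h.symm

/-- The form is triangular: fibre directions of `T^*H` detect `q`; once `q = 0`, directions in `P`
see only `-ω_P` and detect `v`; then directions in `H` detect `ρ`. -/
theorem magneticForm_isNondegenerate {ωP : DiffForm 𝓘(ℝ, V) P 2}
    (hωP : DiffForm.IsNondegenerate 𝓘(ℝ, V) ωP)
    (hBP : ∀ g : H, DiffForm.pullback 𝓘(ℝ, V) (𝓘(ℝ, E).prod 𝓘(ℝ, V)) (fun p : P => (g, p)) B = ωP) :
    DiffForm.IsNondegenerate ((cotModel E).prod 𝓘(ℝ, V)) (magneticForm B) := by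
  intro z u hu
  obtain ⟨⟨q, ρ⟩, v⟩ := u
  replace hu : ∀ w : (E × (E →L[ℝ] ℝ)) × V,
    DiffForm.bilin (magneticForm B) z ((q, ρ), v) w = 0 := hu
  have hcan : ∀ a b : E × (E →L[ℝ] ℝ), DiffForm.bilin (canonicalForm E H) z.1 a b =
    b.2 a.1 - a.2 b.1 := canonicalForm_apply z.1
  simp only [magneticForm_bilin, hcan] at hu
  have hq : q = 0 := by
    refine SeparatingDual.eq_zero_of_forall_dual_eq_zero (R := ℝ) fun σ => ?_
    have h := hu ((0, σ), 0)
    simpa [← Prod.zero_eq_mk] using h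
  subst hq
  have hv : v = 0 := by
    refine hωP.bilin (x := z.2) fun w => ?_
    have h := hu ((0, 0), w)
    rw [← bilin_slice hBP z.1.1 z.2]
    simpa using h
  subst hv
  have hρ : ρ = 0 := by
    ext a
    have h := hu ((a, 0), 0)
    simpa [← Prod.zero_eq_mk] using h
  rw [hρ]
  rfl

variable [MulAction H P] [ContMDiffSMul 𝓘(ℝ, E) 𝓘(ℝ, V) ∞ H P]

omit [LieGroup 𝓘(ℝ, E) ∞ H] in
theorem tderiv_orbit (x : P) (ξ : E) :
    tderiv 𝓘(ℝ, E) (𝓘(ℝ, E).prod 𝓘(ℝ, V)) (fun h : H => (h * 1, h • x)) 1 ξ =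
      (ξ, infAct E H V x ξ) := by
  simp only [mul_one]
  have hid : MDifferentiableAt 𝓘(ℝ, E) 𝓘(ℝ, E) (fun h : H => h) 1 := mdifferentiableAt_id
  rw [tderiv_prodMk hid (mdifferentiableAt_smul_left E V 1 x), tderiv_id]
  rfl

theorem bilin_diagInvariant (hB : IsDiagInvariant B) (g : H) (x : P) (u v : E × V) :
    DiffForm.bilin B (g, g • x) (leftTrans g u.1, actDeriv V g x u.2)
      (leftTrans g v.1, actDeriv V g x v.2) = DiffForm.bilin B (1, x) u v := by
  have h1 : ∀ v, tderiv (𝓘(ℝ, E).prod 𝓘(ℝ, V)) (𝓘(ℝ, E).prod 𝓘(ℝ, V))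
      (fun z : H × P => (g * z.1, g • z.2)) (1, x) v =
        (leftTrans g v.1, actDeriv V g x v.2) := by
    intro v
    have h2 := (mdifferentiableAt_leftMul (E := E) g 1).comp
      ((1, x) : H × P) (I := 𝓘(ℝ, E).prod 𝓘(ℝ, V)) (f := Prod.fst) mdifferentiableAt_fst
    have h3 := (mdifferentiableAt_smul_right E V g x).comp
      ((1, x) : H × P) (I := 𝓘(ℝ, E).prod 𝓘(ℝ, V)) (f := Prod.snd) mdifferentiableAt_snd
    refine (congrArg (fun L : E × V →L[ℝ] E × V => L v) (tderiv_prodMk h2 h3)).trans ?_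
    rw [ContinuousLinearMap.prod_apply, tderiv_comp ((1, x) : H × P)
      (mdifferentiableAt_leftMul (E := E) g 1) mdifferentiableAt_fst, tderiv_comp ((1, x) : H × P)
      (mdifferentiableAt_smul_right E V g x) mdifferentiableAt_snd, tderiv_fst, tderiv_snd]
    rfl
  have h := DiffForm.bilin_pullback (I := 𝓘(ℝ, E).prod 𝓘(ℝ, V)) (I' := 𝓘(ℝ, E).prod 𝓘(ℝ, V))
    (fun z : H × P => (g * z.1, g • z.2)) B (1, x) u v
  rw [h1, h1, hB g, mul_one] at h
  exact h.symm

variable {φ : H × P → LieDual E}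

omit [LieGroup 𝓘(ℝ, E) ∞ H] [ContMDiffSMul 𝓘(ℝ, E) 𝓘(ℝ, V) ∞ H P] in
theorem IsBgPotential.mdifferentiable (hφ : IsBgPotential B φ) :
    MDifferentiable (𝓘(ℝ, E).prod 𝓘(ℝ, V)) 𝓘(ℝ, LieDual E) φ :=
  hφ.smooth.mdifferentiable (by simp)

omit [LieGroup 𝓘(ℝ, E) ∞ H] in
theorem IsBgPotential.bilin_orbit (hφ : IsBgPotential B φ) (x : P) (ξ : E) (v : E × V) :
    DiffForm.bilin B (1, x) (ξ, infAct E H V x ξ) v =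
      tderiv (𝓘(ℝ, E).prod 𝓘(ℝ, V)) 𝓘(ℝ, LieDual E) φ (1, x) v ξ := by
  have h := hφ.potential ξ (1, x) v
  have h1 : (fundVF ξ ((1, x) : H × P) : E × V) = (ξ, infAct E H V x ξ) := tderiv_orbit x ξ
  have h2 := tderiv_clm_comp (ContinuousLinearMap.apply ℝ ℝ ξ) (hφ.mdifferentiable (1, x)) v
  rw [← h1]
  exact h.trans h2

/-- The two-cocycle at `(e, x)` in terms of the derivative of the potential. -/
theorem twoCocycle_one [FiniteDimensional ℝ E] (hφ : IsBgPotential B φ) (ξ η : E) (x : P) :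
    twoCocycle φ ξ η (1, x) =
      - tderiv (𝓘(ℝ, E).prod 𝓘(ℝ, V)) 𝓘(ℝ, LieDual E) φ (1, x) (ξ, infAct E H V x ξ) η -
        φ (1, x) (lieBr H ξ η) := by
  obtain ⟨hAd, hAd'⟩ := hasDeriv_lieAd_inv (E := E) (H := H) η
  have ho : MDifferentiableAt 𝓘(ℝ, E) (𝓘(ℝ, E).prod 𝓘(ℝ, V)) (fun h : H => (h * 1, h • x)) 1 := by
    simp only [mul_one]
    exact mdifferentiableAt_id.prodMk (mdifferentiableAt_smul_left E V 1 x)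
  have hpt : ((1 : H) * 1, (1 : H) • x) = (1, x) := by simp
  have hφ1 : MDifferentiableAt (𝓘(ℝ, E).prod 𝓘(ℝ, V)) 𝓘(ℝ, LieDual E) φ
    ((1 : H) * 1, (1 : H) • x) := hφ.mdifferentiable _
  have hφo : MDifferentiableAt 𝓘(ℝ, E) 𝓘(ℝ, LieDual E) (fun h : H => φ (h * 1, h • x)) 1 :=
    hφ1.comp (1 : H) ho
  have h1 := mdifferentiableAt_clm_comp (ContinuousLinearMap.apply ℝ ℝ η) hφo
  have h2 := mdifferentiableAt_clm_comp (φ (1, x)) hAd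
  have h3 := congrArg (fun L : E →L[ℝ] ℝ => L ξ) (tderiv_neg_add h1 h2)
  refine h3.trans ?_
  rw [add_apply, neg_apply, tderiv_clm_comp _ hφo,
    tderiv_clm_comp _ hAd, hAd', map_neg, tderiv_comp_apply (I' := 𝓘(ℝ, E).prod 𝓘(ℝ, V)) (1 : H)
    (f := fun h : H => (h * 1, h • x)) hφ1 ho, tderiv_orbit, hpt]
  rfl

/-- At `(e, x)` the cocycle is `B(ξ_{H × P}, η_{H × P}) - ⟨φ, [ξ, η]⟩`, and both terms are skew. -/
theorem twoCocycle_swap [FiniteDimensional ℝ E] (hφ : IsBgPotential B φ) (ξ η : E) (x : P) :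
    twoCocycle φ ξ η (1, x) = - twoCocycle φ η ξ (1, x) := by
  have hbr : lieBr H ξ η = - lieBr H η ξ := VectorField.mlieBracket_swap_apply
  rw [twoCocycle_one hφ, twoCocycle_one hφ, ← hφ.bilin_orbit, ← hφ.bilin_orbit,
    DiffForm.bilin_swap, hbr, map_neg]
  ring

/-- The magnetic form in terms of the left-trivialised `H`-components `ξ`, `η` of two tangent
vectors and of the derivative of the quotient map, shifted by the potential. -/
theorem magneticForm_reduced [FiniteDimensional ℝ E] {ωP : DiffForm 𝓘(ℝ, V) P 2}
    (hBP : ∀ g : H, DiffForm.pullback 𝓘(ℝ, V) (𝓘(ℝ, E).prod 𝓘(ℝ, V)) (fun p : P => (g, p)) B = ωP)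
    (hB : IsDiagInvariant B) (hφ : IsBgPotential B φ) (z : Cotangent E H × P)
    (u w : (E × (E →L[ℝ] ℝ)) × V) (ξ η : E) (x : P) (hx : x = z.1.1⁻¹ • z.2)
    (hu : u.1.1 = leftTrans z.1.1 ξ) (hw : w.1.1 = leftTrans z.1.1 η) (a b : V)
    (ha : a = tderiv ((cotModel E).prod 𝓘(ℝ, V)) 𝓘(ℝ, V)
      (fun z : Cotangent E H × P => z.1.1⁻¹ • z.2) z u)
    (hb : b = tderiv ((cotModel E).prod 𝓘(ℝ, V)) 𝓘(ℝ, V)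
      (fun z : Cotangent E H × P => z.1.1⁻¹ • z.2) z w) :
    DiffForm.bilin (magneticForm B) z u w =
      (tderiv (cotModel E) 𝓘(ℝ, LieDual E) leftMomentum z.1 w.1 -
        tderiv (𝓘(ℝ, E).prod 𝓘(ℝ, V)) 𝓘(ℝ, LieDual E) φ (1, x) (0, b)) ξ -
      (tderiv (cotModel E) 𝓘(ℝ, LieDual E) leftMomentum z.1 u.1 -
        tderiv (𝓘(ℝ, E).prod 𝓘(ℝ, V)) 𝓘(ℝ, LieDual E) φ (1, x) (0, a)) η +
      (leftMomentum z.1 - φ (1, x)) (lieBr H ξ η) -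
      DiffForm.bilin ωP x a b - twoCocycle φ ξ η (1, x) := by
  have hu2 := snd_eq_actDeriv z u ξ hu
  have hw2 := snd_eq_actDeriv z w η hw
  rw [← ha, ← hx] at hu2
  rw [← hb, ← hx] at hw2
  have hz2 : z.2 = z.1.1 • x := by rw [hx, smul_inv_smul]
  have h1 := bilin_diagInvariant hB z.1.1 x (ξ, infAct E H V x ξ + a) (η, infAct E H V x η + b)
  have hcan : DiffForm.bilin (canonicalForm E H) z.1 u.1 w.1 = _ :=
    canonicalForm_leftTrans z.1 u.1 w.1 ξ η hu hw
  -- Orbit vector plus slice vector. Of the four resulting terms of `B`, orbit-orbit gives the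
  -- cocycle and `⟨φ, [ξ, η]⟩`, mixed ones give derivatives of `φ`, slice-slice gives `ω_P`.
  have e1 : (ξ, infAct E H V x ξ + a) = (ξ, infAct E H V x ξ) + (0, a) := by simp
  have e2 : (η, infAct E H V x η + b) = (η, infAct E H V x η) + (0, b) := by simp
  rw [magneticForm_bilin, hcan, hu, hw, hu2, hw2, hz2, h1, e1, e2]
  simp only [map_add, LinearMap.add_apply]
  have h2 := DiffForm.bilin_swap B (1, x) (0, a) (η, infAct E H V x η)
  have h3 := DiffForm.bilin_swap B (1, x) (ξ, infAct E H V x ξ) (η, infAct E H V x η)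
  rw [h2, h3, bilin_slice hBP, twoCocycle_one hφ]
  simp only [hφ.bilin_orbit, sub_apply]
  ring

end Magnetic

/-! ### Hamiltonian vector fields -/

section Hamiltonian

variable {E : Type*} [NormedAddCommGroup E] [NormedSpace ℝ E] [FiniteDimensional ℝ E]
  {K : Type*} [TopologicalSpace K] {I : ModelWithCorners ℝ E K}
  {M : Type*} [TopologicalSpace M] [ChartedSpace K M]

/-- In finite dimension the injective map `u ↦ om(u, ·)` is onto the dual, so the default value `0`
in the definition never occurs. -/
theorem DiffForm.IsNondegenerate.bilin_hamiltonianVectorField {om : DiffForm I M 2}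
    (h : DiffForm.IsNondegenerate I om) (F : M → ℝ) (x : M) (v : E) :
    DiffForm.bilin om x (hamiltonianVectorField I om F x) v = tderiv I 𝓘(ℝ, ℝ) F x v := by
  have hinj : Function.Injective (DiffForm.bilin om x) := by
    rw [injective_iff_map_eq_zero]
    exact fun u hu => h.bilin fun v => by rw [hu]; rfl
  have hsurj := (LinearMap.injective_iff_surjective_of_finrank_eq_finrank
    (Subspace.dual_finrank_eq (K := ℝ) (V := E)).symm).1 hinj
  obtain ⟨X, hX⟩ := hsurj (tderiv I 𝓘(ℝ, ℝ) F x : E →ₗ[ℝ] ℝ)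
  have hex : ∃ X : TangentSpace I x, ∀ v : TangentSpace I x,
      om x ![X, v] = mfderiv I 𝓘(ℝ, ℝ) F x v :=
    ⟨X, fun v => congrArg (fun L : E →ₗ[ℝ] ℝ => L v) hX⟩
  unfold hamiltonianVectorField
  rw [dif_pos hex]
  exact hex.choose_spec v

end Hamiltonian

/-! ### The shifted quotient map -/

section Reduction

variable {E : Type*} [NormedAddCommGroup E] [NormedSpace ℝ E] [FiniteDimensional ℝ E]
  {H : Type*} [TopologicalSpace H] [ChartedSpace E H] [Group H] [LieGroup 𝓘(ℝ, E) ∞ H]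
  {V : Type*} [NormedAddCommGroup V] [NormedSpace ℝ V]
  {P : Type*} [TopologicalSpace P] [ChartedSpace V P]
  [MulAction H P] [ContMDiffSMul 𝓘(ℝ, E) 𝓘(ℝ, V) ∞ H P]
  {B : DiffForm (𝓘(ℝ, E).prod 𝓘(ℝ, V)) (H × P) 2} {φ : H × P → LieDual E}

omit [FiniteDimensional ℝ E] [ChartedSpace V P] [TopologicalSpace P]
  [ContMDiffSMul 𝓘(ℝ, E) 𝓘(ℝ, V) ∞ H P] in
theorem reductionMap_one (m : LieDual E × P) :
    reductionMap ((⟨1, m.1⟩ : Cotangent E H), m.2) = m := by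
  refine Prod.ext ?_ ?_
  · change m.1.comp (leftTrans (1 : H)) = m.1
    rw [leftTrans_one, ContinuousLinearMap.comp_id]
  · change (1 : H)⁻¹ • m.2 = m.2
    rw [inv_one, one_smul]

/-- The `P`-component of the derivative of the quotient map. -/
def pointDeriv (z : Cotangent E H × P) : (E × (E →L[ℝ] ℝ)) × V →L[ℝ] V :=
  tderiv ((cotModel E).prod 𝓘(ℝ, V)) 𝓘(ℝ, V) (fun z : Cotangent E H × P => z.1.1⁻¹ • z.2) z

/-- The `𝔥^*`-component of the derivative of the shifted quotient map. -/
def shiftedMomentumDeriv (φ : H × P → LieDual E) (z : Cotangent E H × P) :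
    (E × (E →L[ℝ] ℝ)) × V →L[ℝ] LieDual E :=
  (tderiv (cotModel E) 𝓘(ℝ, LieDual E) leftMomentum z.1).comp (ContinuousLinearMap.fst ℝ _ V) -
    (tderiv (𝓘(ℝ, E).prod 𝓘(ℝ, V)) 𝓘(ℝ, LieDual E) φ (1, z.1.1⁻¹ • z.2)).comp
      ((ContinuousLinearMap.inr ℝ E V).comp (pointDeriv z))

/-- The composite is `(T^*L_g α_g - φ(e, g⁻¹p), g⁻¹p)`; as the first argument of `φ` stays at `e`,
only its `P`-derivative enters. -/
theorem hasDeriv_shift_reduction (hφ : IsBgPotential B φ) (z : Cotangent E H × P) :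
    MDifferentiableAt ((cotModel E).prod 𝓘(ℝ, V)) (redModel E V)
      (fun z : Cotangent E H × P => shiftMap φ (reductionMap z)) z ∧
    tderiv ((cotModel E).prod 𝓘(ℝ, V)) (redModel E V)
      (fun z : Cotangent E H × P => shiftMap φ (reductionMap z)) z =
      (shiftedMomentumDeriv φ z).prod (pointDeriv z) := by
  have h1 : MDifferentiableAt ((cotModel E).prod 𝓘(ℝ, V)) 𝓘(ℝ, LieDual E)
      (fun z : Cotangent E H × P => leftMomentum z.1) z :=
    (mdifferentiableAt_leftMomentum z.1).comp z mdifferentiableAt_fst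
  have hY := mdifferentiable_inv_smul (E := E) (H := H) (V := V) z
  have h2 : MDifferentiableAt ((cotModel E).prod 𝓘(ℝ, V)) (𝓘(ℝ, E).prod 𝓘(ℝ, V))
      (fun z : Cotangent E H × P => ((1 : H), z.1.1⁻¹ • z.2)) z :=
    mdifferentiableAt_const.prodMk hY
  have h3 : MDifferentiableAt ((cotModel E).prod 𝓘(ℝ, V)) 𝓘(ℝ, LieDual E)
      (fun z : Cotangent E H × P => φ (1, z.1.1⁻¹ • z.2)) z :=
    (hφ.mdifferentiable (1, z.1.1⁻¹ • z.2)).comp z h2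
  have h4 : MDifferentiableAt ((cotModel E).prod 𝓘(ℝ, V)) 𝓘(ℝ, LieDual E)
      (fun z : Cotangent E H × P => leftMomentum z.1 - φ (1, z.1.1⁻¹ • z.2)) z := h1.sub h3
  refine ⟨h4.prodMk hY, (tderiv_prodMk h4 hY).trans ?_⟩
  refine congrArg (fun L : (E × (E →L[ℝ] ℝ)) × V →L[ℝ] LieDual E => L.prod (pointDeriv z)) ?_
  have h5 := tderiv_comp z (f := Prod.fst) (mdifferentiableAt_leftMomentum (E := E) (H := H) z.1)
    (mdifferentiableAt_fst (I := cotModel E) (I' := 𝓘(ℝ, V)))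
  have h6 := tderiv_comp z (f := fun z : Cotangent E H × P => ((1 : H), z.1.1⁻¹ • z.2))
    (hφ.mdifferentiable (1, z.1.1⁻¹ • z.2)) h2
  rw [tderiv_sub h1 h3]
  rw [tderiv_fst] at h5
  rw [tderiv_prodMk mdifferentiableAt_const hY, tderiv_const] at h6
  refine (congrArg₂ (fun a b => a - b) h5 h6).trans ?_
  exact ContinuousLinearMap.ext fun w => rfl

/-- A tangent vector of `T^*H × P` is determined by its left-trivialised `H`-component and its
image under the derivative of the shifted quotient map, and these can be prescribed. -/
theorem exists_tangent [FiniteDimensional ℝ V] (φ : H × P → LieDual E) (z : Cotangent E H × P)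
    (ξ : E) (n : LieDual E) (b : V) :
    ∃ w : (E × (E →L[ℝ] ℝ)) × V, w.1.1 = leftTrans z.1.1 ξ ∧ shiftedMomentumDeriv φ z w = n ∧
      pointDeriv z w = b := by
  let J : E →L[ℝ] E := tderiv 𝓘(ℝ, E) 𝓘(ℝ, E) (fun h : H => z.1.1⁻¹ * h) z.1.1
  have hJ : ∀ a, leftTrans z.1.1 (J a) = a := fun a =>
    congrArg (fun L : E →L[ℝ] E => L a) (leftTrans_inverse z.1.1).2
  have hJ' : ∀ a, J (leftTrans z.1.1 a) = a := fun a =>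
    congrArg (fun L : E →L[ℝ] E => L a) (leftTrans_inverse z.1.1).1
  -- The three data form an endomorphism of a finite-dimensional space, so injectivity suffices. If
  -- they vanish, then so do in turn the base, the `P`- and the fibre component.
  let Λ : (E × (E →L[ℝ] ℝ)) × V →L[ℝ] (E × (E →L[ℝ] ℝ)) × V :=
    ((J ∘L ContinuousLinearMap.fst ℝ E (E →L[ℝ] ℝ) ∘L ContinuousLinearMap.fst ℝ _ V).prod
      (shiftedMomentumDeriv φ z)).prod (pointDeriv z)
  have hinj : Function.Injective (Λ : (E × (E →L[ℝ] ℝ)) × V →ₗ[ℝ] (E × (E →L[ℝ] ℝ)) × V) := by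
    rw [injective_iff_map_eq_zero]
    intro w hw
    have h1 : J w.1.1 = 0 := congrArg (fun t => t.1.1) hw
    have h2 : shiftedMomentumDeriv φ z w = 0 := congrArg (fun t => t.1.2) hw
    have h3 : pointDeriv z w = 0 := congrArg (fun t => t.2) hw
    have h4 : w.1.1 = 0 := by rw [← hJ w.1.1, h1, map_zero]
    have h5 : w.2 = 0 := by
      rw [snd_eq_actDeriv z w 0 (by rw [h4, map_zero])]
      change actDeriv V z.1.1 (z.1.1⁻¹ • z.2) (infAct E H V (z.1.1⁻¹ • z.2) 0 + pointDeriv z w) = 0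
      rw [h3, map_zero, add_zero, map_zero]
    have h6 : w.1.2 = 0 := by
      ext a
      obtain ⟨η, rfl⟩ := (leftTrans_bijective (E := E) z.1.1).2 a
      have h7 : tderiv (cotModel E) 𝓘(ℝ, LieDual E) leftMomentum z.1 w.1 -
        tderiv (𝓘(ℝ, E).prod 𝓘(ℝ, V)) 𝓘(ℝ, LieDual E) φ (1, z.1.1⁻¹ • z.2)
          (0, pointDeriv z w) = 0 := h2
      rw [h3, ← Prod.zero_eq_mk, map_zero, sub_zero] at h7
      have h8 := tderiv_leftMomentum z.1 w.1 η
      rw [h7, h4, map_zero, map_zero, zero_add] at h8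
      exact h8.symm
    exact Prod.ext (Prod.ext h4 h6) h5
  obtain ⟨w, hw⟩ := LinearMap.surjective_of_injective hinj ((ξ, n), b)
  refine ⟨w, ?_, congrArg (fun t => t.1.2) hw, congrArg (fun t => t.2) hw⟩
  have h1 : J w.1.1 = ξ := congrArg (fun t => t.1.1) hw
  rw [← h1, hJ]

theorem tderiv_pullback (hφ : IsBgPotential B φ) {f : LieDual E × P → ℝ}
    (hf : MDifferentiable (redModel E V) 𝓘(ℝ, ℝ) f) (z : Cotangent E H × P)
    (w : (E × (E →L[ℝ] ℝ)) × V) :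
    tderiv ((cotModel E).prod 𝓘(ℝ, V)) 𝓘(ℝ, ℝ)
      ((f ∘ shiftMap φ) ∘ (reductionMap : Cotangent E H × P → LieDual E × P)) z w =
      shiftedMomentumDeriv φ z w (funDeriv f (shiftMap φ (reductionMap z))) +
      tderiv 𝓘(ℝ, V) 𝓘(ℝ, ℝ) (fun y => f ((shiftMap φ (reductionMap z)).1, y))
        (z.1.1⁻¹ • z.2) (pointDeriv z w) := by
  obtain ⟨h1, h2⟩ := hasDeriv_shift_reduction hφ z
  refine (tderiv_comp_apply z (g := f) (hf _) h1 w).trans ?_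
  rw [h2, ContinuousLinearMap.prod_apply, apply_funDeriv, ← tderiv_eq_fderiv]
  exact mfderiv_prod_eq_add_apply (I := 𝓘(ℝ, LieDual E)) (I' := 𝓘(ℝ, V)) (hf _)

theorem lieBr_zero (ξ : E) : lieBr H ξ 0 = 0 := by
  have := lieGroup_minSmoothness_three E H
  exact lie_zero (L := GroupLieAlgebra 𝓘(ℝ, E) H) (M := GroupLieAlgebra 𝓘(ℝ, E) H) ξ

/-- The bracket of `Ω` of functions pulled back by the shifted quotient map. -/
theorem symplecticBracket_pullback [FiniteDimensional ℝ V] {ωP : DiffForm 𝓘(ℝ, V) P 2}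
    (hωP : DiffForm.IsNondegenerate 𝓘(ℝ, V) ωP)
    (hBP : ∀ g : H, DiffForm.pullback 𝓘(ℝ, V) (𝓘(ℝ, E).prod 𝓘(ℝ, V)) (fun p : P => (g, p)) B = ωP)
    (hB : IsDiagInvariant B) (hφ : IsBgPotential B φ) (ε : ℝ) {f k : LieDual E × P → ℝ}
    (hf : MDifferentiable (redModel E V) 𝓘(ℝ, ℝ) f)
    (hk : MDifferentiable (redModel E V) 𝓘(ℝ, ℝ) k) (z : Cotangent E H × P) :
    symplecticBracket ((cotModel E).prod 𝓘(ℝ, V)) ε (magneticForm B)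
      ((f ∘ shiftMap φ) ∘ reductionMap) ((k ∘ shiftMap φ) ∘ reductionMap) z =
      naturalBracket ε ωP φ f k (shiftMap φ (reductionMap z)) := by
  set x := z.1.1⁻¹ • z.2 with hx
  set m := shiftMap φ (reductionMap z) with hm
  have hm1 : m.1 = leftMomentum z.1 - φ (1, x) := rfl
  set X : (E × (E →L[ℝ] ℝ)) × V := hamiltonianVectorField ((cotModel E).prod 𝓘(ℝ, V))
    (magneticForm B) ((k ∘ shiftMap φ) ∘ reductionMap) z with hX
  obtain ⟨ξ, hξ⟩ := (leftTrans_bijective (E := E) z.1.1).2 X.1.1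
  -- Hamilton's equation for `X`, tested on the vector with arbitrarily prescribed data `(η, n, b)`.
  have key : ∀ (η : E) (n : LieDual E) (b : V),
      n ξ - shiftedMomentumDeriv φ z X η + m.1 (lieBr H ξ η) -
        DiffForm.bilin ωP x (pointDeriv z X) b - twoCocycle φ ξ η (1, x) =
      n (funDeriv k m) + tderiv 𝓘(ℝ, V) 𝓘(ℝ, ℝ) (fun y => k (m.1, y)) x b := by
    intro η n b
    obtain ⟨w, hw1, hw2, hw3⟩ := exists_tangent φ z η n b
    have h1 := magneticForm_reduced hBP hB hφ z X w ξ η x hx hξ.symm hw1 (pointDeriv z X)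
      (pointDeriv z w) rfl rfl
    have h2 := (magneticForm_isNondegenerate hωP hBP).bilin_hamiltonianVectorField
      ((k ∘ shiftMap φ) ∘ reductionMap) z w
    have h3 : tderiv (cotModel E) 𝓘(ℝ, LieDual E) leftMomentum z.1 w.1 -
        tderiv (𝓘(ℝ, E).prod 𝓘(ℝ, V)) 𝓘(ℝ, LieDual E) φ (1, x) (0, pointDeriv z w) = n := hw2
    have h4 : tderiv (cotModel E) 𝓘(ℝ, LieDual E) leftMomentum z.1 X.1 -
        tderiv (𝓘(ℝ, E).prod 𝓘(ℝ, V)) 𝓘(ℝ, LieDual E) φ (1, x) (0, pointDeriv z X) =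
          shiftedMomentumDeriv φ z X := rfl
    rw [h3, h4, ← hm1, hw3] at h1
    rw [tderiv_pullback hφ hk, hw2, hw3] at h2
    exact h1.symm.trans h2
  have hcocycle : ∀ η, twoCocycle φ η 0 (1, x) = 0 := fun η => by
    rw [twoCocycle_one hφ, lieBr_zero, map_zero, map_zero, neg_zero, sub_zero]
  -- Test with `(0, n, 0)`.
  have hξk : ξ = funDeriv k m := by
    rw [← sub_eq_zero]
    refine SeparatingDual.eq_zero_of_forall_dual_eq_zero (R := ℝ) fun n => ?_
    have h := key 0 n 0
    simp only [lieBr_zero, hcocycle, map_zero, sub_zero, add_zero] at h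
    rw [map_sub, h, sub_self]
  set Y : V := hamiltonianVectorField 𝓘(ℝ, V) ωP (fun y => k (m.1, y)) x
  -- Test with `(0, 0, b)`. The minus sign comes from `-ω_P` in the reduced form of `Ω`.
  have hpt : pointDeriv z X = - Y := by
    rw [eq_neg_iff_add_eq_zero]
    refine hωP.bilin (x := x) fun b => ?_
    have h := key 0 0 b
    have h2 : DiffForm.bilin ωP x Y b = _ :=
      hωP.bilin_hamiltonianVectorField (fun y => k (m.1, y)) x b
    simp only [lieBr_zero, hcocycle, map_zero, sub_zero, add_zero, zero_apply, zero_add, zero_sub] at h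
    rw [map_add, LinearMap.add_apply, h2, ← h, add_neg_cancel]
  -- With `η = δf/δμ` this determines the one value of the momentum part of `X` that enters its
  -- derivative of `f ∘ Ŝ ∘ π`.
  have hmom := key (funDeriv f m) 0 0
  simp only [map_zero, sub_zero, add_zero, zero_apply, zero_sub] at hmom
  have hbr : lieBr H (funDeriv k m) (funDeriv f m) = - lieBr H (funDeriv f m) (funDeriv k m) :=
    VectorField.mlieBracket_swap_apply
  rw [hξk, twoCocycle_swap hφ, hbr, map_neg] at hmom
  have hnat : naturalBracket ε ωP φ f k m = -ε * m.1 (lieBr H (funDeriv f m) (funDeriv k m)) -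
      ε * tderiv 𝓘(ℝ, V) 𝓘(ℝ, ℝ) (fun y => f (m.1, y)) x Y +
      ε * twoCocycle φ (funDeriv f m) (funDeriv k m) (1, x) := rfl
  have hF := tderiv_pullback hφ hf z X
  rw [hpt, map_neg] at hF
  have hint : symplecticBracket ((cotModel E).prod 𝓘(ℝ, V)) ε (magneticForm B)
      ((f ∘ shiftMap φ) ∘ reductionMap) ((k ∘ shiftMap φ) ∘ reductionMap) z =
      ε * tderiv ((cotModel E).prod 𝓘(ℝ, V)) 𝓘(ℝ, ℝ)
        ((f ∘ shiftMap φ) ∘ reductionMap) z X := rfl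
  rw [hint, hF, hnat]
  linear_combination (-ε) * hmom

end Reduction

/-! ### The shift map is a Poisson isomorphism -/

section Shift

variable {E : Type*} [NormedAddCommGroup E] [NormedSpace ℝ E]
  {H : Type*} [TopologicalSpace H] [ChartedSpace E H] [Group H]
  {V : Type*} [NormedAddCommGroup V] [NormedSpace ℝ V]
  {P : Type*} [TopologicalSpace P] [ChartedSpace V P]

theorem contMDiff_const_add_potential {φ : H × P → LieDual E}
    (hφ : ContMDiff (𝓘(ℝ, E).prod 𝓘(ℝ, V)) 𝓘(ℝ, LieDual E) ∞ φ) :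
    ContMDiff (redModel E V) 𝓘(ℝ, LieDual E) ∞ (fun m : LieDual E × P => φ (1, m.2)) :=
  hφ.comp (contMDiff_const.prodMk contMDiff_snd)

/-- The shift map as a diffeomorphism. -/
def shiftDiffeomorph (φ : H × P → LieDual E)
    (hφ : ContMDiff (𝓘(ℝ, E).prod 𝓘(ℝ, V)) 𝓘(ℝ, LieDual E) ∞ φ) :
    (LieDual E × P) ≃ₘ^∞⟮redModel E V, redModel E V⟯ (LieDual E × P) where
  toFun := shiftMap φ
  invFun m := (m.1 + φ (1, m.2), m.2)
  left_inv m := by simp [shiftMap]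
  right_inv m := by simp [shiftMap]
  contMDiff_toFun :=
    (contMDiff_fst.sub (contMDiff_const_add_potential hφ)).prodMk contMDiff_snd
  contMDiff_invFun :=
    (contMDiff_fst.add (contMDiff_const_add_potential hφ)).prodMk contMDiff_snd

end Shift

end

/-! ### The main theorem -/

theorem mainTheorem2
    {E : Type*} [NormedAddCommGroup E] [NormedSpace ℝ E] [FiniteDimensional ℝ E]
    {H : Type*} [TopologicalSpace H] [ChartedSpace E H] [Group H]
    [LieGroup 𝓘(ℝ, E) ∞ H]
    {V : Type*} [NormedAddCommGroup V] [NormedSpace ℝ V] [FiniteDimensional ℝ V]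
    {P : Type*} [TopologicalSpace P] [ChartedSpace V P] [IsManifold 𝓘(ℝ, V) ∞ P]
    [MulAction H P] [ContMDiffSMul 𝓘(ℝ, E) 𝓘(ℝ, V) ∞ H P]
    (ωP : DiffForm 𝓘(ℝ, V) P 2) (hωP : DiffForm.IsSymplectic 𝓘(ℝ, V) ωP)
    (hωPinv : ∀ h : H, DiffForm.pullback 𝓘(ℝ, V) 𝓘(ℝ, V) (fun p : P => h • p) ωP = ωP)
    (B : DiffForm (𝓘(ℝ, E).prod 𝓘(ℝ, V)) (H × P) 2)
    (hBsmooth : DiffForm.IsSmooth (𝓘(ℝ, E).prod 𝓘(ℝ, V)) B)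
    (hBclosed : DiffForm.IsClosed (𝓘(ℝ, E).prod 𝓘(ℝ, V)) B)
    (hBinv : IsDiagInvariant B)
    (hBP : ∀ g : H, DiffForm.pullback 𝓘(ℝ, V) (𝓘(ℝ, E).prod 𝓘(ℝ, V))
      (fun p : P => (g, p)) B = ωP)
    (φ : H × P → LieDual E) (hφ : IsBgPotential B φ)
    (ε : ℝ) (hε : ε = 1 ∨ ε = -1) :
    DiffForm.IsNondegenerate ((cotModel E).prod 𝓘(ℝ, V)) (magneticForm B) ∧
    (∀ f k : LieDual E × P → ℝ,
      ContMDiff (redModel E V) 𝓘(ℝ, ℝ) ∞ f → ContMDiff (redModel E V) 𝓘(ℝ, ℝ) ∞ k →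
      symplecticBracket ((cotModel E).prod 𝓘(ℝ, V)) ε (magneticForm B)
          (f ∘ reductionMap (H := H)) (k ∘ reductionMap (H := H)) =
        interactionBracket ε B f k ∘ reductionMap) ∧
    IsPoissonIso (V := V) (interactionBracket ε B) (naturalBracket ε ωP φ) (shiftMap φ) := by
  have hnd := hωP.nondegenerate
  have hsmooth : ∀ {f : LieDual E × P → ℝ}, ContMDiff (redModel E V) 𝓘(ℝ, ℝ) ∞ f →
      MDifferentiable (redModel E V) 𝓘(ℝ, ℝ) f := fun hf => hf.mdifferentiable (by simp)
  refine ⟨magneticForm_isNondegenerate hnd hBP, fun f k hf hk => ?_,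
    ⟨shiftDiffeomorph φ hφ.smooth, rfl⟩, fun f k hf hk => ?_⟩
  -- Writing `f = (f ∘ Ŝ⁻¹) ∘ Ŝ` and likewise `k`, the bracket at `z` depends on `π(z)` only, so it
  -- may be evaluated at the representative over the identity.
  · let D := shiftDiffeomorph φ hφ.smooth
    have hf' : ContMDiff (redModel E V) 𝓘(ℝ, ℝ) ∞ (f ∘ D.symm) := hf.comp D.symm.contMDiff
    have hk' : ContMDiff (redModel E V) 𝓘(ℝ, ℝ) ∞ (k ∘ D.symm) := hk.comp D.symm.contMDiff
    have h1 : ∀ g : LieDual E × P → ℝ, (g ∘ D.symm) ∘ shiftMap φ = g := fun g =>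
      funext fun m => congrArg g (D.symm_apply_apply m)
    have h2 := fun z => symplecticBracket_pullback hnd hBP hBinv hφ ε (hsmooth hf') (hsmooth hk') z
    simp only [h1] at h2
    funext z
    rw [h2, Function.comp_apply, interactionBracket, h2, reductionMap_one]
  · funext m
    rw [interactionBracket, symplecticBracket_pullback hnd hBP hBinv hφ ε (hsmooth hf) (hsmooth hk),
      reductionMap_one, Function.comp_apply]
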